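/- Let $k$ be a field of characteristic $p>0$. Let $G_0$ be an infinitesimal group scheme over $k$, i.e. an affine group scheme whose coordinate algebra $k[G_0]$ is finite dimensional and local, let $\pi$ be a finite group acting on $G_0$ by group scheme automorphisms, and let $G$ be a finite group scheme over $k$ which is identified with the semi-direct product $G_0\rtimes\pi$ (with $\pi$ regarded as a constant group scheme). Let $\pi_S\subset\pi$ be a $p$-Sylow subgroup and put $G_S=G_0\rtimes\pi_S$. For a rational $G$-module $M$ (i.e. a $k[G]$-comodule, of arbitrary dimension) and $n\ge 0$, let $H^n(G,M)=\operatorname{Ext}^n_G(k,M)$, with Ext taken in the category of rational $G$-modules, and similarly for $G_S$. Then for every rational $G$-module $M$ and every $n\ge 0$ the restriction map $H^n(G,M)\to H^n(G_S,M)$ induced by the embedding $G_S=G_0\rtimes\pi_S\hookrightarrow G_0\rtimes\pi=G$ is injective. -/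

import Mathlib

open scoped TensorProduct

universe u v v' w

/-- An action of the finite group `π` on the affine group scheme `G₀ = Spec A₀` by group scheme
automorphisms, given by comorphisms: `α.comorphism x` is the map of coordinate algebras
`f ↦ (g ↦ f (x(g)))` belonging to the automorphism `g ↦ x(g)` of `G₀`. -/
structure GroupSchemeAction (k π A₀ : Type*) [CommSemiring k] [Group π] [CommSemiring A₀]
    [Bialgebra k A₀] where
  comorphism : π → (A₀ →ₐc[k] A₀)
  comorphism_one : comorphism 1 = BialgHom.id k A₀
  comorphism_mul : ∀ x y, comorphism (x * y) = (comorphism y).comp (comorphism x)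

namespace GroupSchemeAction

section Defs

variable {k π A₀ : Type*} [Field k] [Group π] [CommRing A₀] [HopfAlgebra k A₀]

/-- The restriction of an action of `π` to a subgroup. -/
def restrict (α : GroupSchemeAction k π A₀) (H : Subgroup π) : GroupSchemeAction k H A₀ where
  comorphism x := α.comorphism x
  comorphism_one := α.comorphism_one
  comorphism_mul x y := α.comorphism_mul x y

/-- The coordinate algebra `k[G₀ ⋊ π]`. As a scheme, `G₀ ⋊ π` is the disjoint union of copies
`G₀ × {x}` of `G₀`, for `x ∈ π`, so its coordinate algebra is the product algebra `π → A₀`: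
the component `F x` is the function `g ↦ F (g, x)` on `G₀`. -/
def SemidirectCoord (_α : GroupSchemeAction k π A₀) := π → A₀

variable (α : GroupSchemeAction k π A₀)

noncomputable instance : CommRing α.SemidirectCoord := inferInstanceAs (CommRing (π → A₀))

noncomputable instance : Algebra k α.SemidirectCoord := inferInstanceAs (Algebra k (π → A₀))

/-- `F ↦ F (·, x)`, restriction of functions to the component `G₀ × {x}`. -/
noncomputable def component (x : π) : α.SemidirectCoord →ₐ[k] A₀ :=
  Pi.evalAlgHom k (fun _ : π => A₀) x

open Classical in
/-- Extension by zero of a function on `G₀ × {x}`. -/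
noncomputable def extend (x : π) : A₀ →ₗ[k] α.SemidirectCoord :=
  LinearMap.single k (fun _ : π => A₀) x

lemma component_extend_same (x : π) (a : A₀) : α.component x (α.extend x a) = a := by
  classical
  exact Pi.single_eq_same (M := fun _ : π => A₀) x a

lemma component_extend_ne {x y : π} (h : x ≠ y) (a : A₀) :
    α.component x (α.extend y a) = 0 := by
  classical
  exact Pi.single_eq_of_ne (M := fun _ : π => A₀) h a

lemma component_comp_extend_same (x : π) :
    (α.component x).toLinearMap ∘ₗ α.extend x = LinearMap.id :=
  LinearMap.ext (α.component_extend_same x)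

lemma component_comp_extend_ne {x y : π} (h : x ≠ y) :
    (α.component x).toLinearMap ∘ₗ α.extend y = 0 :=
  LinearMap.ext (α.component_extend_ne h)

lemma coord_ext {F F' : α.SemidirectCoord} (h : ∀ x, α.component x F = α.component x F') :
    F = F' :=
  funext h

/-- The map `A₀ → A₀ ⊗ A₀` sending a function `f` on `G₀` to the function
`(g₁, g₂) ↦ f (g₁ · x(g₂))`. -/
noncomputable def twistedComul (x : π) : A₀ →ₐ[k] A₀ ⊗[k] A₀ :=
  (Algebra.TensorProduct.map (AlgHom.id k A₀) (α.comorphism x : A₀ →ₐ[k] A₀)).comp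
    (Bialgebra.comulAlgHom k A₀)

lemma sum_extend_component [Fintype π] :
    ∑ x, α.extend x ∘ₗ (α.component x).toLinearMap = LinearMap.id := by
  classical
  ext F
  apply α.coord_ext
  intro y
  simp only [LinearMap.coe_sum, Finset.sum_apply, LinearMap.comp_apply, map_sum,
    AlgHom.toLinearMap_apply, LinearMap.id_apply]
  rw [Finset.sum_eq_single y]
  · exact α.component_extend_same _ _
  · intro b _ hb
    exact α.component_extend_ne hb.symm _
  · simp

lemma comorphism_counit (x : π) (a : A₀) :
    Coalgebra.counit (R := k) (α.comorphism x a) = Coalgebra.counit (R := k) a :=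
  CoalgHomClass.counit_comp_apply (α.comorphism x) a

lemma comorphism_mul_apply (x y : π) (a : A₀) :
    α.comorphism (x * y) a = α.comorphism y (α.comorphism x a) := by
  rw [α.comorphism_mul]; rfl

lemma comorphism_one_apply (a : A₀) : α.comorphism 1 a = a := by
  rw [α.comorphism_one]; rfl

lemma comul_comorphism (x : π) (a : A₀) :
    Coalgebra.comul (R := k) (α.comorphism x a) =
      Algebra.TensorProduct.map (α.comorphism x : A₀ →ₐ[k] A₀) (α.comorphism x : A₀ →ₐ[k] A₀)
        (Coalgebra.comul (R := k) a) :=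
  (CoalgHomClass.map_comp_comul_apply (α.comorphism x) a).symm

lemma twistedComul_apply (x : π) (a : A₀) :
    α.twistedComul x a = Algebra.TensorProduct.map (AlgHom.id k A₀)
      (α.comorphism x : A₀ →ₐ[k] A₀) (Coalgebra.comul (R := k) a) := rfl

lemma twistedComul_coassoc (x y : π) (a : A₀) :
    Algebra.TensorProduct.assoc k k k A₀ A₀ A₀
      (Algebra.TensorProduct.map (α.twistedComul x) (AlgHom.id k A₀) (α.twistedComul (x * y) a)) =
    Algebra.TensorProduct.map (AlgHom.id k A₀) (α.twistedComul y) (α.twistedComul x a) := by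
  have h1 : ∀ u : A₀ ⊗[k] A₀, Algebra.TensorProduct.assoc k k k A₀ A₀ A₀
      (Algebra.TensorProduct.map (α.twistedComul x) (AlgHom.id k A₀)
        (Algebra.TensorProduct.map (AlgHom.id k A₀)
          (α.comorphism (x * y) : A₀ →ₐ[k] A₀) u)) =
      Algebra.TensorProduct.map (AlgHom.id k A₀) (Algebra.TensorProduct.map
        (α.comorphism x : A₀ →ₐ[k] A₀) (α.comorphism (x * y) : A₀ →ₐ[k] A₀))
        (TensorProduct.assoc k A₀ A₀ A₀ ((Coalgebra.comul (R := k)).rTensor A₀ u)) := by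
    intro u
    induction u with
    | zero => simp
    | add a b ha hb => simp only [map_add, ha, hb]
    | tmul a b =>
      simp only [Algebra.TensorProduct.map_tmul, twistedComul_apply, LinearMap.rTensor_tmul,
        AlgHom.id_apply]
      generalize Coalgebra.comul (R := k) a = w
      induction w with
      | zero => simp
      | add a b ha hb => simp only [map_add, TensorProduct.add_tmul, ha, hb]
      | tmul a b => simp
  have h2 : ∀ u : A₀ ⊗[k] A₀, Algebra.TensorProduct.map (AlgHom.id k A₀) (α.twistedComul y)
        (Algebra.TensorProduct.map (AlgHom.id k A₀) (α.comorphism x : A₀ →ₐ[k] A₀) u) =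
      Algebra.TensorProduct.map (AlgHom.id k A₀) (Algebra.TensorProduct.map
        (α.comorphism x : A₀ →ₐ[k] A₀) (α.comorphism (x * y) : A₀ →ₐ[k] A₀))
        ((Coalgebra.comul (R := k)).lTensor A₀ u) := by
    intro u
    induction u with
    | zero => simp
    | add a b ha hb => simp only [map_add, ha, hb]
    | tmul a b =>
      simp only [Algebra.TensorProduct.map_tmul, twistedComul_apply, LinearMap.lTensor_tmul]
      congr 1
      have h3 : Coalgebra.comul (R := k) ((α.comorphism x : A₀ →ₐ[k] A₀) b) = _ :=
        α.comul_comorphism x b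
      rw [h3]
      generalize Coalgebra.comul (R := k) b = w
      induction w with
      | zero => simp
      | add a b ha hb => simp only [map_add, ha, hb]
      | tmul a b => simp [comorphism_mul_apply]
  rw [α.twistedComul_apply, h1, Coalgebra.coassoc_apply, α.twistedComul_apply x, h2]

/-- The counit: evaluation at the neutral element `(1, 1)`. -/
noncomputable def counitHom : α.SemidirectCoord →ₐ[k] k :=
  (Bialgebra.counitAlgHom k A₀).comp (α.component 1)

/-- The antipode, dual to `(g, x)⁻¹ = (x⁻¹(g⁻¹), x⁻¹)`. -/
noncomputable def antipodeLinear : α.SemidirectCoord →ₗ[k] α.SemidirectCoord :=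
  LinearMap.pi (φ := fun _ : π => A₀) fun x =>
    HopfAlgebra.antipode k (A := A₀) ∘ₗ ((α.comorphism x⁻¹ : A₀ →ₐ[k] A₀)).toLinearMap ∘ₗ
      (α.component x⁻¹).toLinearMap

lemma component_antipodeLinear (x : π) (F : α.SemidirectCoord) :
    α.component x (α.antipodeLinear F) =
      HopfAlgebra.antipode k (α.comorphism x⁻¹ (α.component x⁻¹ F)) := rfl

variable [Finite π]

/-- An element of `k[G] ⊗ V` is determined by its components. -/
lemma rTensor_ext {V : Type*} [AddCommGroup V] [Module k V] {s t : α.SemidirectCoord ⊗[k] V}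
    (h : ∀ x, (α.component x).toLinearMap.rTensor V s = (α.component x).toLinearMap.rTensor V t) :
    s = t := by
  have := Fintype.ofFinite π
  have key : ∀ s : α.SemidirectCoord ⊗[k] V,
      s = ∑ x, (α.extend x).rTensor V ((α.component x).toLinearMap.rTensor V s) := by
    intro s
    have h1 := congrArg (fun f => LinearMap.rTensor V f s) α.sum_extend_component
    simp only [LinearMap.rTensor_id, LinearMap.id_apply, ← LinearMap.coe_rTensorHom, map_sum] at h1
    simpa [LinearMap.rTensor_comp] using h1.symm
  rw [key s, key t]
  simp [h]

lemma lTensor_ext {V : Type*} [AddCommGroup V] [Module k V] {s t : V ⊗[k] α.SemidirectCoord}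
    (h : ∀ x, (α.component x).toLinearMap.lTensor V s = (α.component x).toLinearMap.lTensor V t) :
    s = t := by
  apply (TensorProduct.comm k V α.SemidirectCoord).injective
  apply α.rTensor_ext
  intro x
  have h2 : ∀ u, (α.component x).toLinearMap.rTensor V (TensorProduct.comm k V α.SemidirectCoord u)
      = TensorProduct.comm k V A₀ ((α.component x).toLinearMap.lTensor V u) := by
    intro u
    induction u with
    | zero => simp
    | tmul a b => simp
    | add a b ha hb => simp only [map_add, ha, hb]
  rw [h2, h2, h x]

lemma tensor_ext {s t : α.SemidirectCoord ⊗[k] α.SemidirectCoord}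
    (h : ∀ x y, Algebra.TensorProduct.map (α.component x) (α.component y) s =
      Algebra.TensorProduct.map (α.component x) (α.component y) t) : s = t := by
  apply α.rTensor_ext
  intro x
  apply α.lTensor_ext
  intro y
  have h2 : ∀ u, (α.component y).toLinearMap.lTensor A₀
      ((α.component x).toLinearMap.rTensor α.SemidirectCoord u)
      = Algebra.TensorProduct.map (α.component x) (α.component y) u := by
    intro u
    induction u with
    | zero => simp
    | tmul a b => simp
    | add a b ha hb => simp only [map_add, ha, hb]
  rw [h2, h2, h x y]

open Classical in
/-- The comultiplication of `k[G₀ ⋊ π]` as a linear map, dual to the multiplication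
`(g₁, x₁) (g₂, x₂) = (g₁ · x₁(g₂), x₁ x₂)`: on the component `(G₀ × {x₁}) × (G₀ × {x₂})` it is
`F ↦ ((g₁, g₂) ↦ F (g₁ · x₁(g₂), x₁ x₂))`. -/
noncomputable def comulLinear : α.SemidirectCoord →ₗ[k] α.SemidirectCoord ⊗[k] α.SemidirectCoord :=
  letI := Fintype.ofFinite π
  ∑ x₁ : π, ∑ x₂ : π, TensorProduct.map (α.extend x₁) (α.extend x₂) ∘ₗ
    (α.twistedComul x₁).toLinearMap ∘ₗ (α.component (x₁ * x₂)).toLinearMap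

lemma component_comulLinear (x y : π) (F : α.SemidirectCoord) :
    Algebra.TensorProduct.map (α.component x) (α.component y) (α.comulLinear F) =
      α.twistedComul x (α.component (x * y) F) := by
  classical
  let _ := Fintype.ofFinite π
  have key : ∀ (x' y' : π) (u : A₀ ⊗[k] A₀),
      Algebra.TensorProduct.map (α.component x) (α.component y)
        (TensorProduct.map (α.extend x') (α.extend y') u) =
      if x = x' ∧ y = y' then u else 0 := by
    intro x' y' u
    have : ∀ u, Algebra.TensorProduct.map (α.component x) (α.component y)
        (TensorProduct.map (α.extend x') (α.extend y') u) =
        TensorProduct.map ((α.component x).toLinearMap ∘ₗ α.extend x')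
          ((α.component y).toLinearMap ∘ₗ α.extend y') u := by
      intro u
      rw [TensorProduct.map_comp]; rfl
    rw [this]
    by_cases hx : x = x'
    · by_cases hy : y = y'
      · subst hx hy
        simp [component_comp_extend_same]
      · simp [hy, component_comp_extend_ne]
    · simp [hx, component_comp_extend_ne]
  simp only [comulLinear, LinearMap.coe_sum, Finset.sum_apply, LinearMap.comp_apply, map_sum, key]
  rw [Finset.sum_eq_single x, Finset.sum_eq_single y]
  · simp
  · intro b _ hb
    simp [hb.symm]
  · simp
  · intro b _ hb
    simp [hb.symm]
  · simp

noncomputable def comulHom : α.SemidirectCoord →ₐ[k] α.SemidirectCoord ⊗[k] α.SemidirectCoord :=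
  AlgHom.ofLinearMap α.comulLinear
    (α.tensor_ext fun x y => by rw [component_comulLinear]; simp only [map_one])
    (fun F F' => α.tensor_ext fun x y => by
      rw [map_mul (Algebra.TensorProduct.map (α.component x) (α.component y))]
      simp only [component_comulLinear, map_mul])

lemma component_comulHom (x y : π) (F : α.SemidirectCoord) :
    Algebra.TensorProduct.map (α.component x) (α.component y) (α.comulHom F) =
      α.twistedComul x (α.component (x * y) F) :=
  α.component_comulLinear x y F

lemma tensor_ext₃ {s t : α.SemidirectCoord ⊗[k] (α.SemidirectCoord ⊗[k] α.SemidirectCoord)}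
    (h : ∀ x y z, Algebra.TensorProduct.map (α.component x)
        (Algebra.TensorProduct.map (α.component y) (α.component z)) s =
      Algebra.TensorProduct.map (α.component x)
        (Algebra.TensorProduct.map (α.component y) (α.component z)) t) : s = t := by
  apply α.rTensor_ext
  intro x
  apply (TensorProduct.assoc k A₀ α.SemidirectCoord α.SemidirectCoord).symm.injective
  apply α.lTensor_ext
  intro z
  apply (TensorProduct.assoc k A₀ α.SemidirectCoord A₀).injective
  apply (TensorProduct.comm k _ _).injective
  apply (TensorProduct.assoc k _ _ _).injective
  apply α.rTensor_ext
  intro y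
  have h2 : ∀ u, (α.component y).toLinearMap.rTensor (A₀ ⊗[k] A₀) (TensorProduct.assoc k _ _ _
      (TensorProduct.comm k _ _ ((TensorProduct.assoc k A₀ α.SemidirectCoord A₀)
      ((α.component z).toLinearMap.lTensor (A₀ ⊗[k] α.SemidirectCoord)
      ((TensorProduct.assoc k A₀ α.SemidirectCoord α.SemidirectCoord).symm
      ((α.component x).toLinearMap.rTensor (α.SemidirectCoord ⊗[k] α.SemidirectCoord) u)))))) =
      TensorProduct.assoc k _ _ _ (TensorProduct.comm k _ _
        (Algebra.TensorProduct.map (α.component x)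
        (Algebra.TensorProduct.map (α.component y) (α.component z)) u)) := by
    intro u
    induction u with
    | zero => simp
    | add a b ha hb => simp only [map_add, ha, hb]
    | tmul a b =>
      induction b with
      | zero => simp
      | add b b' hb hb' => simp only [TensorProduct.tmul_add, map_add, hb, hb']
      | tmul b c => simp
  rw [h2, h2, h x y z]


noncomputable instance : Bialgebra k α.SemidirectCoord :=
  Bialgebra.ofAlgHom α.comulHom α.counitHom
    (by
      refine AlgHom.ext fun F => α.tensor_ext₃ fun x y z => ?_
      have h1 : ∀ u : α.SemidirectCoord ⊗[k] α.SemidirectCoord,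
          Algebra.TensorProduct.map (α.component x)
            (Algebra.TensorProduct.map (α.component y) (α.component z))
            (Algebra.TensorProduct.assoc k k k _ _ _
              (Algebra.TensorProduct.map α.comulHom (AlgHom.id k _) u)) =
          Algebra.TensorProduct.assoc k k k _ _ _
            (Algebra.TensorProduct.map (α.twistedComul x) (AlgHom.id k A₀)
              (Algebra.TensorProduct.map (α.component (x * y)) (α.component z) u)) := by
        intro u
        induction u with
        | zero => simp
        | add a b ha hb => simp only [map_add, ha, hb]
        | tmul a b =>
          simp only [Algebra.TensorProduct.map_tmul, ← component_comulHom]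
          generalize α.comulHom a = w
          induction w with
          | zero => simp
          | add a b ha hb => simp only [map_add, TensorProduct.add_tmul, ha, hb]
          | tmul a b => simp
      have h2 : ∀ u : α.SemidirectCoord ⊗[k] α.SemidirectCoord,
          Algebra.TensorProduct.map (α.component x)
            (Algebra.TensorProduct.map (α.component y) (α.component z))
            (Algebra.TensorProduct.map (AlgHom.id k _) α.comulHom u) =
          Algebra.TensorProduct.map (AlgHom.id k A₀) (α.twistedComul y)
              (Algebra.TensorProduct.map (α.component x) (α.component (y * z)) u) := by
        intro u
        induction u with
        | zero => simp
        | add a b ha hb => simp only [map_add, ha, hb]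
        | tmul a b => simp [component_comulHom]
      refine (h1 (α.comulHom F)).trans (Eq.trans ?_ (h2 (α.comulHom F)).symm)
      rw [component_comulHom, component_comulHom, ← mul_assoc]
      exact α.twistedComul_coassoc x y _)
    (by
      refine AlgHom.ext fun F => α.lTensor_ext fun y => ?_
      have h1 : ∀ u : α.SemidirectCoord ⊗[k] α.SemidirectCoord,
          (α.component y).toLinearMap.lTensor k
            (Algebra.TensorProduct.map α.counitHom (AlgHom.id k _) u) =
          (Coalgebra.counit (R := k)).rTensor A₀
            (Algebra.TensorProduct.map (α.component 1) (α.component y) u) := by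
        intro u
        induction u with
        | zero => simp
        | add a b ha hb => simp only [map_add, ha, hb]
        | tmul a b => simp [counitHom]
      refine (h1 (α.comulHom F)).trans ?_
      rw [component_comulHom, twistedComul_apply, one_mul, α.comorphism_one]
      have h2 : Algebra.TensorProduct.map (AlgHom.id k A₀)
          ((BialgHom.id k A₀ : A₀ →ₐc[k] A₀) : A₀ →ₐ[k] A₀) = AlgHom.id k _ :=
        Algebra.TensorProduct.map_id
      rw [h2, AlgHom.id_apply, Coalgebra.rTensor_counit_comul]
      simp)
    (by
      refine AlgHom.ext fun F => α.rTensor_ext fun x => ?_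
      have h1 : ∀ u : α.SemidirectCoord ⊗[k] α.SemidirectCoord,
          (α.component x).toLinearMap.rTensor k
            (Algebra.TensorProduct.map (AlgHom.id k _) α.counitHom u) =
          (Coalgebra.counit (R := k)).lTensor A₀
            (Algebra.TensorProduct.map (α.component x) (α.component 1) u) := by
        intro u
        induction u with
        | zero => simp
        | add a b ha hb => simp only [map_add, ha, hb]
        | tmul a b => simp [counitHom]
      have h2 : ∀ u : A₀ ⊗[k] A₀, (Coalgebra.counit (R := k)).lTensor A₀
          (Algebra.TensorProduct.map (AlgHom.id k A₀) (α.comorphism x : A₀ →ₐ[k] A₀) u) =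
          (Coalgebra.counit (R := k)).lTensor A₀ u := by
        intro u
        induction u with
        | zero => simp
        | add a b ha hb => simp only [map_add, ha, hb]
        | tmul a b => simp
      refine (h1 (α.comulHom F)).trans ?_
      rw [component_comulHom, twistedComul_apply, h2, mul_one, Coalgebra.lTensor_counit_comul]
      simp)

lemma comul_eq (F : α.SemidirectCoord) : Coalgebra.comul (R := k) F = α.comulHom F := rfl

lemma counit_eq (F : α.SemidirectCoord) :
    Coalgebra.counit (R := k) F = Coalgebra.counit (R := k) (α.component 1 F) := rfl

noncomputable instance : HopfAlgebra k α.SemidirectCoord where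
  antipode := α.antipodeLinear
  mul_antipode_rTensor_comul := by
    refine LinearMap.ext fun F => α.coord_ext fun x => ?_
    have h1 : ∀ u : α.SemidirectCoord ⊗[k] α.SemidirectCoord,
        α.component x (LinearMap.mul' k _ (α.antipodeLinear.rTensor _ u)) =
        LinearMap.mul' k A₀ (TensorProduct.map
          (HopfAlgebra.antipode k ∘ₗ (α.comorphism x⁻¹ : A₀ →ₐ[k] A₀).toLinearMap) LinearMap.id
          (Algebra.TensorProduct.map (α.component x⁻¹) (α.component x) u)) := by
      intro u
      induction u with
      | zero => simp
      | add a b ha hb => simp only [map_add, ha, hb]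
      | tmul a b => simp [component_antipodeLinear]
    have h2 : ∀ u : A₀ ⊗[k] A₀,
        LinearMap.mul' k A₀ (TensorProduct.map
          (HopfAlgebra.antipode k ∘ₗ (α.comorphism x⁻¹ : A₀ →ₐ[k] A₀).toLinearMap) LinearMap.id
          (Algebra.TensorProduct.map (AlgHom.id k A₀) (α.comorphism x⁻¹ : A₀ →ₐ[k] A₀) u)) =
        LinearMap.mul' k A₀ ((HopfAlgebra.antipode k).rTensor A₀
          (Algebra.TensorProduct.map (α.comorphism x⁻¹ : A₀ →ₐ[k] A₀)
            (α.comorphism x⁻¹ : A₀ →ₐ[k] A₀) u)) := by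
      intro u
      induction u with
      | zero => simp
      | add a b ha hb => simp only [map_add, ha, hb]
      | tmul a b => simp
    refine (h1 _).trans ?_
    rw [comul_eq, component_comulHom, twistedComul_apply, h2, ← comul_comorphism,
      HopfAlgebra.mul_antipode_rTensor_comul_apply, comorphism_counit, inv_mul_cancel]
    simp [counit_eq]
  mul_antipode_lTensor_comul := by
    refine LinearMap.ext fun F => α.coord_ext fun x => ?_
    have h1 : ∀ u : α.SemidirectCoord ⊗[k] α.SemidirectCoord,
        α.component x (LinearMap.mul' k _ (α.antipodeLinear.lTensor _ u)) =
        LinearMap.mul' k A₀ (TensorProduct.map LinearMap.id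
          (HopfAlgebra.antipode k ∘ₗ (α.comorphism x⁻¹ : A₀ →ₐ[k] A₀).toLinearMap)
          (Algebra.TensorProduct.map (α.component x) (α.component x⁻¹) u)) := by
      intro u
      induction u with
      | zero => simp
      | add a b ha hb => simp only [map_add, ha, hb]
      | tmul a b => simp [component_antipodeLinear]
    have h2 : ∀ u : A₀ ⊗[k] A₀,
        LinearMap.mul' k A₀ (TensorProduct.map LinearMap.id
          (HopfAlgebra.antipode k ∘ₗ (α.comorphism x⁻¹ : A₀ →ₐ[k] A₀).toLinearMap)
          (Algebra.TensorProduct.map (AlgHom.id k A₀) (α.comorphism x : A₀ →ₐ[k] A₀) u)) =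
        LinearMap.mul' k A₀ ((HopfAlgebra.antipode k).lTensor A₀ u) := by
      intro u
      induction u with
      | zero => simp
      | add a b ha hb => simp only [map_add, ha, hb]
      | tmul a b =>
        simp [← comorphism_mul_apply, comorphism_one_apply]
    refine (h1 _).trans ?_
    rw [comul_eq, component_comulHom, twistedComul_apply, h2,
      HopfAlgebra.mul_antipode_lTensor_comul_apply, mul_inv_cancel]
    simp [counit_eq]

/-- The algebra map underlying `restrictCoord`. -/
noncomputable def restrictCoordHom (H : Subgroup π) :
    α.SemidirectCoord →ₐ[k] (α.restrict H).SemidirectCoord :=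
  AlgHom.pi (fun x : H => α.component (x : π))

/-- The comorphism `k[G₀ ⋊ π] → k[G₀ ⋊ H]` of the embedding `G₀ ⋊ H ↪ G₀ ⋊ π`, for a subgroup
`H` of `π`: restriction of functions to the components `G₀ × {x}` with `x ∈ H`. -/
noncomputable def restrictCoord (H : Subgroup π) :
    α.SemidirectCoord →ₐc[k] (α.restrict H).SemidirectCoord :=
  BialgHom.ofAlgHom (α.restrictCoordHom H) (AlgHom.ext fun F => rfl)
    (by
      refine AlgHom.ext fun F => (α.restrict H).tensor_ext fun x y => ?_
      have h1 : ∀ u : α.SemidirectCoord ⊗[k] α.SemidirectCoord,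
          Algebra.TensorProduct.map ((α.restrict H).component x) ((α.restrict H).component y)
            (Algebra.TensorProduct.map (α.restrictCoordHom H) (α.restrictCoordHom H) u) =
          Algebra.TensorProduct.map (α.component (x : π)) (α.component (y : π)) u := by
        intro u
        induction u with
        | zero => simp
        | add a b ha hb => simp only [map_add, ha, hb]
        | tmul a b => rfl
      refine (h1 (α.comulHom F)).trans ?_
      refine (α.component_comulHom x y F).trans ?_
      exact ((α.restrict H).component_comulHom x y (α.restrictCoordHom H F)).symm)

lemma component_restrictCoord (H : Subgroup π) (x : H) (F : α.SemidirectCoord) :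
    (α.restrict H).component x (α.restrictCoord H F) = α.component (x : π) F := rfl

end Defs

end GroupSchemeAction

/-- A rational `G`-module, for the affine group scheme `G = Spec A` over `k`: a `k`-vector space
`M`, of any dimension, with a (right) comodule structure `M → M ⊗ k[G]` over the coordinate
algebra `A = k[G]`. (A left action of `G` on `M` is given by `g · m = ∑ g(aᵢ) mᵢ`
for `coact m = ∑ mᵢ ⊗ aᵢ`.) -/
structure RationalModule.{t, r, s} (k : Type r) (A : Type s) [Field k] [CommRing A]
    [Bialgebra k A] where
  carrier : Type t
  [addCommGroup : AddCommGroup carrier]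
  [module : Module k carrier]
  coact : carrier →ₗ[k] carrier ⊗[k] A
  coassoc : (TensorProduct.assoc k carrier A A).toLinearMap ∘ₗ coact.rTensor A ∘ₗ coact =
    (Coalgebra.comul (R := k) (A := A)).lTensor carrier ∘ₗ coact
  counit_coact : (TensorProduct.rid k carrier).toLinearMap ∘ₗ
    (Coalgebra.counit (R := k) (A := A)).lTensor carrier ∘ₗ coact = LinearMap.id

namespace RationalModule

open CategoryTheory CategoryTheory.Limits

attribute [instance] RationalModule.addCommGroup RationalModule.module

section Category

variable {k : Type u} {A : Type v} [Field k] [CommRing A] [Bialgebra k A]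

lemma coassoc_apply (M : RationalModule.{w} k A) (m : M.carrier) :
    TensorProduct.assoc k M.carrier A A (M.coact.rTensor A (M.coact m)) =
      (Coalgebra.comul (R := k) (A := A)).lTensor M.carrier (M.coact m) :=
  LinearMap.congr_fun M.coassoc m

lemma counit_coact_apply (M : RationalModule.{w} k A) (m : M.carrier) :
    TensorProduct.rid k M.carrier
      ((Coalgebra.counit (R := k) (A := A)).lTensor M.carrier (M.coact m)) = m :=
  LinearMap.congr_fun M.counit_coact m

/-- A homomorphism of rational `G`-modules: a linear map compatible with the coactions. -/
@[ext]
structure Hom (M N : RationalModule.{w} k A) where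
  toLin : M.carrier →ₗ[k] N.carrier
  comm : N.coact ∘ₗ toLin = toLin.rTensor A ∘ₗ M.coact

lemma Hom.comm_apply {M N : RationalModule.{w} k A} (f : Hom M N) (m : M.carrier) :
    N.coact (f.toLin m) = f.toLin.rTensor A (M.coact m) :=
  LinearMap.congr_fun f.comm m

instance : Category (RationalModule.{w} k A) where
  Hom M N := Hom M N
  id M := ⟨LinearMap.id, by simp⟩
  comp f g := ⟨g.toLin ∘ₗ f.toLin, by
    rw [← LinearMap.comp_assoc, g.comm, LinearMap.comp_assoc, f.comm, LinearMap.rTensor_comp,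
      LinearMap.comp_assoc]⟩

/-- The linear map underlying a morphism. -/
def lin {M N : RationalModule.{w} k A} (f : M ⟶ N) : M.carrier →ₗ[k] N.carrier := Hom.toLin f

lemma hom_ext {M N : RationalModule.{w} k A} {f g : M ⟶ N} (h : lin f = lin g) : f = g :=
  Hom.ext h

lemma lin_comm {M N : RationalModule.{w} k A} (f : M ⟶ N) (m : M.carrier) :
    N.coact (lin f m) = (lin f).rTensor A (M.coact m) :=
  Hom.comm_apply f m

/-- Construct a morphism from a linear map. -/
def homMk {M N : RationalModule.{w} k A} (f : M.carrier →ₗ[k] N.carrier)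
    (h : ∀ m, N.coact (f m) = f.rTensor A (M.coact m)) : M ⟶ N :=
  (⟨f, LinearMap.ext h⟩ : Hom M N)

@[simp] lemma lin_homMk {M N : RationalModule.{w} k A} (f : M.carrier →ₗ[k] N.carrier) (h) :
    lin (homMk (M := M) (N := N) f h) = f := rfl

@[simp] lemma lin_id (M : RationalModule.{w} k A) : lin (𝟙 M) = LinearMap.id := rfl

@[simp] lemma lin_comp {M N L : RationalModule.{w} k A} (f : M ⟶ N) (g : N ⟶ L) :
    lin (f ≫ g) = lin g ∘ₗ lin f := rfl

section Preadditive

variable (M N : RationalModule.{w} k A)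

instance : Zero (M ⟶ N) := ⟨homMk 0 (by simp)⟩
instance : Add (M ⟶ N) :=
  ⟨fun f g => homMk (lin f + lin g) (by simp [lin_comm, LinearMap.rTensor_add])⟩
instance : Neg (M ⟶ N) :=
  ⟨fun f => homMk (-lin f) (by simp [lin_comm, LinearMap.rTensor_neg])⟩
instance : Sub (M ⟶ N) :=
  ⟨fun f g => homMk (lin f - lin g) (by simp [lin_comm, LinearMap.rTensor_sub])⟩
instance : SMul ℕ (M ⟶ N) :=
  ⟨fun n f => homMk (n • lin f) (by
    intro m
    rw [← Nat.cast_smul_eq_nsmul k n (lin f)]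
    simp [lin_comm, LinearMap.rTensor_smul])⟩
instance : SMul ℤ (M ⟶ N) :=
  ⟨fun n f => homMk (n • lin f) (by
    intro m
    rw [← Int.cast_smul_eq_zsmul k n (lin f)]
    simp [lin_comm, LinearMap.rTensor_smul])⟩

variable {M N}

@[simp] lemma lin_zero : lin (0 : M ⟶ N) = 0 := rfl
@[simp] lemma lin_add (f g : M ⟶ N) : lin (f + g) = lin f + lin g := rfl
@[simp] lemma lin_neg (f : M ⟶ N) : lin (-f) = -lin f := rfl
@[simp] lemma lin_sub (f g : M ⟶ N) : lin (f - g) = lin f - lin g := rfl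

instance : AddCommGroup (M ⟶ N) :=
  Function.Injective.addCommGroup (lin : (M ⟶ N) → _) (fun _ _ h => hom_ext h) rfl
    (fun _ _ => rfl) (fun _ => rfl) (fun _ _ => rfl) (fun _ _ => rfl) (fun _ _ => rfl)

end Preadditive

instance : Preadditive (RationalModule.{w} k A) where
  add_comp _ _ _ f f' g := hom_ext (by simp [LinearMap.comp_add])
  comp_add _ _ _ f g g' := hom_ext (by simp [LinearMap.add_comp])

/-- The zero module. -/
def zeroModule : RationalModule.{w} k A where
  carrier := PUnit
  coact := 0
  coassoc := by simp
  counit_coact := Subsingleton.elim _ _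

instance : HasZeroObject (RationalModule.{w} k A) :=
  ⟨zeroModule, by
    rw [IsZero.iff_id_eq_zero]
    exact hom_ext (LinearMap.ext fun _ => Subsingleton.elim (α := PUnit) _ _)⟩

section Transfer

variable {V W : Type*} [AddCommGroup V] [Module k V] [AddCommGroup W] [Module k W]
  {ρ : V →ₗ[k] V ⊗[k] A} {σ : W →ₗ[k] W ⊗[k] A} {i : V →ₗ[k] W}

lemma transfer_left (h : ∀ v, σ (i v) = i.rTensor A (ρ v)) (v : V) :
    TensorProduct.assoc k W A A (σ.rTensor A (σ (i v))) =
      i.rTensor (A ⊗[k] A) (TensorProduct.assoc k V A A (ρ.rTensor A (ρ v))) := by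
  have h1 : σ ∘ₗ i = i.rTensor A ∘ₗ ρ := LinearMap.ext h
  rw [h, ← LinearMap.comp_apply (σ.rTensor A), ← LinearMap.rTensor_comp, h1,
    LinearMap.rTensor_comp, LinearMap.comp_apply]
  generalize ρ.rTensor A (ρ v) = u
  induction u with
  | zero => simp
  | add a b ha hb => simp only [map_add, ha, hb]
  | tmul a b =>
    induction a with
    | zero => simp
    | add a b ha hb => simp only [map_add, TensorProduct.add_tmul, ha, hb]
    | tmul a b => simp

lemma transfer_right (h : ∀ v, σ (i v) = i.rTensor A (ρ v)) (v : V) :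
    (Coalgebra.comul (R := k) (A := A)).lTensor W (σ (i v)) =
      i.rTensor (A ⊗[k] A) ((Coalgebra.comul (R := k) (A := A)).lTensor V (ρ v)) := by
  rw [h]
  generalize ρ v = u
  induction u with
  | zero => simp
  | add a b ha hb => simp only [map_add, ha, hb]
  | tmul a b => simp

lemma transfer_counit (h : ∀ v, σ (i v) = i.rTensor A (ρ v)) (v : V) :
    TensorProduct.rid k W ((Coalgebra.counit (R := k) (A := A)).lTensor W (σ (i v))) =
      i (TensorProduct.rid k V ((Coalgebra.counit (R := k) (A := A)).lTensor V (ρ v))) := by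
  rw [h]
  generalize ρ v = u
  induction u with
  | zero => simp
  | add a b ha hb => simp only [map_add, ha, hb]
  | tmul a b => simp

end Transfer

/-- The direct sum of two rational modules. -/
noncomputable def prodModule (M N : RationalModule.{w} k A) : RationalModule.{w} k A where
  carrier := M.carrier × N.carrier
  coact := LinearMap.coprod ((LinearMap.inl k M.carrier N.carrier).rTensor A ∘ₗ M.coact)
    ((LinearMap.inr k M.carrier N.carrier).rTensor A ∘ₗ N.coact)
  coassoc := by
    refine LinearMap.prod_ext (LinearMap.ext fun m => ?_) (LinearMap.ext fun m => ?_)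
    · refine (transfer_left (ρ := M.coact) (fun v => by simp) m).trans ?_
      rw [coassoc_apply]
      exact (transfer_right (ρ := M.coact) (fun v => by simp) m).symm
    · refine (transfer_left (ρ := N.coact) (fun v => by simp) m).trans ?_
      rw [coassoc_apply]
      exact (transfer_right (ρ := N.coact) (fun v => by simp) m).symm
  counit_coact := by
    refine LinearMap.prod_ext (LinearMap.ext fun m => ?_) (LinearMap.ext fun m => ?_)
    · refine (transfer_counit (ρ := M.coact) (fun v => by simp) m).trans ?_
      rw [counit_coact_apply]
      rfl
    · refine (transfer_counit (ρ := N.coact) (fun v => by simp) m).trans ?_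
      rw [counit_coact_apply]
      rfl

/-- The direct sum as a bicone. -/
noncomputable def prodBicone (M N : RationalModule.{w} k A) : BinaryBicone M N where
  pt := prodModule M N
  fst := homMk (N := M) (LinearMap.fst k M.carrier N.carrier) (by
    have h : ∀ m : M.carrier × N.carrier, M.coact (LinearMap.fst k M.carrier N.carrier m) =
        (LinearMap.fst k M.carrier N.carrier).rTensor A
          ((LinearMap.inl k M.carrier N.carrier).rTensor A (M.coact m.1) +
            (LinearMap.inr k M.carrier N.carrier).rTensor A (N.coact m.2)) := by
      intro m
      rw [map_add, ← LinearMap.rTensor_comp_apply, ← LinearMap.rTensor_comp_apply,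
        LinearMap.fst_comp_inl, LinearMap.fst_comp_inr]
      simp
    exact h)
  snd := homMk (N := N) (LinearMap.snd k M.carrier N.carrier) (by
    have h : ∀ m : M.carrier × N.carrier, N.coact (LinearMap.snd k M.carrier N.carrier m) =
        (LinearMap.snd k M.carrier N.carrier).rTensor A
          ((LinearMap.inl k M.carrier N.carrier).rTensor A (M.coact m.1) +
            (LinearMap.inr k M.carrier N.carrier).rTensor A (N.coact m.2)) := by
      intro m
      rw [map_add, ← LinearMap.rTensor_comp_apply, ← LinearMap.rTensor_comp_apply,
        LinearMap.snd_comp_inl, LinearMap.snd_comp_inr]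
      simp
    exact h)
  inl := homMk (N := prodModule M N) (LinearMap.inl k M.carrier N.carrier)
    (by
      intro m
      change LinearMap.rTensor A _ (M.coact m) + LinearMap.rTensor A _ (N.coact 0) = _
      rw [map_zero, map_zero, add_zero]
      rfl)
  inr := homMk (N := prodModule M N) (LinearMap.inr k M.carrier N.carrier)
    (by
      intro m
      change LinearMap.rTensor A _ (M.coact 0) + LinearMap.rTensor A _ (N.coact m) = _
      rw [map_zero, map_zero, zero_add]
      rfl)
  inl_fst := hom_ext rfl
  inl_snd := hom_ext rfl
  inr_fst := hom_ext rfl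
  inr_snd := hom_ext rfl

instance : HasBinaryBiproducts (RationalModule.{w} k A) :=
  ⟨fun M N => ⟨⟨prodBicone M N, isBinaryBilimitOfTotal _
    (hom_ext (LinearMap.ext fun m => by
      change ((m.1, 0) + (0, m.2) : M.carrier × N.carrier) = m
      simp only [Prod.mk_add_mk, add_zero, zero_add]
      rfl))⟩⟩⟩

instance : HasFiniteProducts (RationalModule.{w} k A) :=
  hasFiniteProducts_of_has_binary_and_terminal

section Kernels

variable {M N : RationalModule.{w} k A} (f : M ⟶ N)

lemma coact_mem_range_of_mem_ker (m : LinearMap.ker (lin f)) :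
    M.coact m ∈ LinearMap.range ((LinearMap.ker (lin f)).subtype.rTensor A) := by
  have h := Module.Flat.rTensor_exact (M := A) (LinearMap.exact_subtype_ker_map (lin f))
  refine (h _).1 ?_
  rw [← lin_comm, m.2, map_zero]

/-- The coaction on the kernel of `f`. -/
noncomputable def kerCoact : LinearMap.ker (lin f) →ₗ[k] LinearMap.ker (lin f) ⊗[k] A :=
  (LinearEquiv.ofInjective ((LinearMap.ker (lin f)).subtype.rTensor A)
    (Module.Flat.rTensor_preserves_injective_linearMap _
      (Submodule.subtype_injective _))).symm.toLinearMap ∘ₗ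
  LinearMap.codRestrict _ (M.coact ∘ₗ (LinearMap.ker (lin f)).subtype)
    (coact_mem_range_of_mem_ker f)

lemma kerCoact_spec (m : LinearMap.ker (lin f)) :
    M.coact ((LinearMap.ker (lin f)).subtype m) =
      (LinearMap.ker (lin f)).subtype.rTensor A (kerCoact f m) := by
  have h := LinearEquiv.apply_symm_apply
    (LinearEquiv.ofInjective ((LinearMap.ker (lin f)).subtype.rTensor A)
    (Module.Flat.rTensor_preserves_injective_linearMap _ (Submodule.subtype_injective _)))
    (LinearMap.codRestrict _ (M.coact ∘ₗ (LinearMap.ker (lin f)).subtype)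
      (coact_mem_range_of_mem_ker f) m)
  exact (congrArg Subtype.val h).symm

/-- The kernel of `f` as a rational module. -/
noncomputable def kerModule : RationalModule.{w} k A where
  carrier := LinearMap.ker (lin f)
  coact := kerCoact f
  coassoc := by
    refine LinearMap.ext fun m => ?_
    apply Module.Flat.rTensor_preserves_injective_linearMap (M := A ⊗[k] A) _
      (Submodule.subtype_injective (LinearMap.ker (lin f)))
    refine (transfer_left (kerCoact_spec f) m).symm.trans ?_
    rw [coassoc_apply]
    exact transfer_right (kerCoact_spec f) m
  counit_coact := by
    refine LinearMap.ext fun m => ?_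
    apply Submodule.subtype_injective (LinearMap.ker (lin f))
    refine (transfer_counit (kerCoact_spec f) m).symm.trans ?_
    rw [counit_coact_apply]
    rfl

/-- The inclusion of the kernel. -/
noncomputable def kerι : kerModule f ⟶ M :=
  homMk (M := kerModule f) (LinearMap.ker (lin f)).subtype (kerCoact_spec f)

lemma kerι_comp : kerι f ≫ f = 0 := hom_ext (LinearMap.ext fun m => m.2)

lemma kerι_injective : Function.Injective (lin (kerι f)) :=
  Submodule.subtype_injective (LinearMap.ker (lin f))

lemma range_kerι : LinearMap.range (lin (kerι f)) = LinearMap.ker (lin f) :=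
  Submodule.range_subtype _

/-- Lifting through an injective morphism. -/
noncomputable def liftInj (hf : Function.Injective (lin f)) {L : RationalModule.{w} k A}
    (g : L ⟶ N) (hg : ∀ x, lin g x ∈ LinearMap.range (lin f)) : L ⟶ M :=
  homMk ((LinearEquiv.ofInjective (lin f) hf).symm.toLinearMap ∘ₗ
    LinearMap.codRestrict _ (lin g) hg) (by
    have h1 : lin f ∘ₗ ((LinearEquiv.ofInjective (lin f) hf).symm.toLinearMap ∘ₗ
        LinearMap.codRestrict _ (lin g) hg) = lin g :=
      LinearMap.ext fun x => congrArg Subtype.val (LinearEquiv.apply_symm_apply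
        (LinearEquiv.ofInjective (lin f) hf) (LinearMap.codRestrict _ (lin g) hg x))
    intro m
    apply Module.Flat.rTensor_preserves_injective_linearMap (M := A) _ hf
    rw [← lin_comm, ← LinearMap.rTensor_comp_apply, h1, ← lin_comm]
    exact congrArg N.coact (LinearMap.congr_fun h1 m))

lemma liftInj_comp (hf : Function.Injective (lin f)) {L : RationalModule.{w} k A}
    (g : L ⟶ N) (hg : ∀ x, lin g x ∈ LinearMap.range (lin f)) : liftInj f hf g hg ≫ f = g :=
  hom_ext (LinearMap.ext fun x => congrArg Subtype.val (LinearEquiv.apply_symm_apply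
    (LinearEquiv.ofInjective (lin f) hf) (LinearMap.codRestrict _ (lin g) hg x)))

/-- An injective morphism with the right image is a kernel. -/
noncomputable def isLimitOfInj {L : RationalModule.{w} k A} (g : N ⟶ L) (w : f ≫ g = 0)
    (hf : Function.Injective (lin f)) (h : LinearMap.range (lin f) = LinearMap.ker (lin g)) :
    IsLimit (KernelFork.ofι f w) :=
  KernelFork.IsLimit.ofι _ _
    (fun j hj => liftInj f hf j (fun x => by
      rw [h]; exact LinearMap.congr_fun (congrArg lin hj) x))
    (fun j hj => liftInj_comp _ _ _ _)
    (fun j hj b hb => by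
      refine hom_ext (LinearMap.ext fun x => hf ?_)
      have h1 := LinearMap.congr_fun (congrArg lin hb) x
      have h2 := LinearMap.congr_fun (congrArg lin (liftInj_comp f hf j (fun x => by
        rw [h]; exact LinearMap.congr_fun (congrArg lin hj) x))) x
      exact h1.trans h2.symm)

instance : HasKernels (RationalModule.{w} k A) :=
  ⟨fun f => ⟨⟨_, isLimitOfInj (kerι f) f (kerι_comp f) (kerι_injective f) (range_kerι f)⟩⟩⟩

lemma injective_of_mono [Mono f] : Function.Injective (lin f) := by
  rw [← LinearMap.ker_eq_bot, ← range_kerι, LinearMap.range_eq_bot]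
  have : kerι f = 0 := by
    rw [← cancel_mono f, kerι_comp, zero_comp]
  rw [this]; rfl

lemma mono_of_injective (h : Function.Injective (lin f)) : Mono f :=
  ⟨fun _ _ hab => hom_ext (LinearMap.ext fun x =>
    h (LinearMap.congr_fun (congrArg lin hab) x))⟩

end Kernels

section Cokernels

variable {M N : RationalModule.{w} k A} (f : M ⟶ N)

/-- The coaction on the cokernel of `f`. -/
noncomputable def cokerCoact : (N.carrier ⧸ LinearMap.range (lin f)) →ₗ[k]
    (N.carrier ⧸ LinearMap.range (lin f)) ⊗[k] A :=
  Submodule.liftQ _ ((LinearMap.range (lin f)).mkQ.rTensor A ∘ₗ N.coact) (by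
    rintro _ ⟨m, rfl⟩
    rw [LinearMap.mem_ker, LinearMap.comp_apply, lin_comm, ← LinearMap.comp_apply,
      ← LinearMap.rTensor_comp, LinearMap.range_mkQ_comp, LinearMap.rTensor_zero,
      LinearMap.zero_apply])

lemma cokerCoact_spec (n : N.carrier) :
    cokerCoact f ((LinearMap.range (lin f)).mkQ n) =
      (LinearMap.range (lin f)).mkQ.rTensor A (N.coact n) := rfl

/-- The cokernel of `f` as a rational module. -/
noncomputable def cokerModule : RationalModule.{w} k A where
  carrier := N.carrier ⧸ LinearMap.range (lin f)
  coact := cokerCoact f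
  coassoc := by
    refine LinearMap.ext fun m => ?_
    obtain ⟨n, rfl⟩ := Submodule.mkQ_surjective _ m
    refine (transfer_left (cokerCoact_spec f) n).trans ?_
    rw [coassoc_apply]
    exact (transfer_right (cokerCoact_spec f) n).symm
  counit_coact := by
    refine LinearMap.ext fun m => ?_
    obtain ⟨n, rfl⟩ := Submodule.mkQ_surjective _ m
    refine (transfer_counit (cokerCoact_spec f) n).trans ?_
    rw [counit_coact_apply]
    rfl

/-- The projection to the cokernel. -/
noncomputable def cokerπ : N ⟶ cokerModule f :=
  homMk (N := cokerModule f) (LinearMap.range (lin f)).mkQ (cokerCoact_spec f)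

lemma comp_cokerπ : f ≫ cokerπ f = 0 := hom_ext (LinearMap.range_mkQ_comp _)

lemma cokerπ_surjective : Function.Surjective (lin (cokerπ f)) :=
  Submodule.mkQ_surjective (LinearMap.range (lin f))

lemma ker_cokerπ : LinearMap.ker (lin (cokerπ f)) = LinearMap.range (lin f) :=
  Submodule.ker_mkQ _

/-- Descending along a surjective morphism. -/
noncomputable def descSurj (hf : Function.Surjective (lin f)) {L : RationalModule.{w} k A}
    (g : M ⟶ L) (hg : LinearMap.ker (lin f) ≤ LinearMap.ker (lin g)) : N ⟶ L :=
  homMk (Submodule.liftQ _ (lin g) hg ∘ₗ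
      ((lin f).quotKerEquivOfSurjective hf).symm.toLinearMap) (by
    have h1 : ∀ m, ((lin f).quotKerEquivOfSurjective hf).symm (lin f m) =
        (LinearMap.ker (lin f)).mkQ m := fun m =>
      (LinearEquiv.symm_apply_eq _).2 rfl
    have h2 : (Submodule.liftQ _ (lin g) hg ∘ₗ
      ((lin f).quotKerEquivOfSurjective hf).symm.toLinearMap) ∘ₗ lin f = lin g :=
      LinearMap.ext fun m => by
        simp only [LinearMap.comp_apply, LinearEquiv.coe_coe, h1]
        simp
    intro n
    obtain ⟨m, rfl⟩ := hf n
    rw [lin_comm f, ← LinearMap.rTensor_comp_apply, h2, ← lin_comm]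
    exact congrArg L.coact (LinearMap.congr_fun h2 m))

lemma comp_descSurj (hf : Function.Surjective (lin f)) {L : RationalModule.{w} k A}
    (g : M ⟶ L) (hg : LinearMap.ker (lin f) ≤ LinearMap.ker (lin g)) :
    f ≫ descSurj f hf g hg = g :=
  hom_ext (LinearMap.ext fun m => by
    have h1 : ((lin f).quotKerEquivOfSurjective hf).symm (lin f m) =
        (LinearMap.ker (lin f)).mkQ m :=
      (LinearEquiv.symm_apply_eq _).2 rfl
    simp only [descSurj, lin_comp, lin_homMk, LinearMap.comp_apply, LinearEquiv.coe_coe, h1]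
    simp)

/-- A surjective morphism with the right kernel is a cokernel. -/
noncomputable def isColimitOfSurj {L : RationalModule.{w} k A} (g : L ⟶ M) (w : g ≫ f = 0)
    (hf : Function.Surjective (lin f)) (h : LinearMap.range (lin g) = LinearMap.ker (lin f)) :
    IsColimit (CokernelCofork.ofπ f w) :=
  have h' : ∀ {Z : RationalModule.{w} k A} (j : M ⟶ Z), g ≫ j = 0 →
      LinearMap.ker (lin f) ≤ LinearMap.ker (lin j) := by
    intro Z j hj
    rw [← h]
    rintro _ ⟨x, rfl⟩
    exact LinearMap.congr_fun (congrArg lin hj) x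
  CokernelCofork.IsColimit.ofπ _ _
    (fun j hj => descSurj f hf j (h' j hj))
    (fun j hj => comp_descSurj _ _ _ _)
    (fun j hj b hb => by
      refine hom_ext (LinearMap.ext fun x => ?_)
      obtain ⟨y, rfl⟩ := hf x
      have h1 := LinearMap.congr_fun (congrArg lin hb) y
      have h2 := LinearMap.congr_fun (congrArg lin (comp_descSurj f hf j (h' j hj))) y
      exact h1.trans h2.symm)

instance : HasCokernels (RationalModule.{w} k A) :=
  ⟨fun f => ⟨⟨_, isColimitOfSurj (cokerπ f) f (comp_cokerπ f) (cokerπ_surjective f)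
    (ker_cokerπ f).symm⟩⟩⟩

lemma surjective_of_epi [Epi f] : Function.Surjective (lin f) := by
  rw [← LinearMap.range_eq_top, ← ker_cokerπ, LinearMap.ker_eq_top]
  have : cokerπ f = 0 := by
    rw [← cancel_epi f, comp_cokerπ, comp_zero]
  rw [this]; rfl

lemma epi_of_surjective (h : Function.Surjective (lin f)) : Epi f :=
  ⟨fun a b hab => hom_ext (LinearMap.ext fun x => by
    obtain ⟨y, rfl⟩ := h x
    exact LinearMap.congr_fun (congrArg lin hab) y)⟩

end Cokernels

/-- Rational `G`-modules form an abelian category. -/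
noncomputable instance : Abelian (RationalModule.{w} k A) where
  normalMonoOfMono f _ := ⟨{
    Z := cokerModule f
    g := cokerπ f
    w := comp_cokerπ f
    isLimit := isLimitOfInj f (cokerπ f) (comp_cokerπ f) (injective_of_mono f)
      (ker_cokerπ f).symm }⟩
  normalEpiOfEpi f _ := ⟨{
    W := kerModule f
    g := kerι f
    w := kerι_comp f
    isColimit := isColimitOfSurj f (kerι f) (kerι_comp f) (surjective_of_epi f)
      (range_kerι f) }⟩

lemma shortExact_iff (S : ShortComplex (RationalModule.{w} k A)) :
    S.ShortExact ↔ Function.Injective (lin S.f) ∧ Function.Surjective (lin S.g) ∧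
      LinearMap.range (lin S.f) = LinearMap.ker (lin S.g) := by
  constructor
  · intro h
    have := h.mono_f
    have := h.epi_g
    refine ⟨injective_of_mono _, surjective_of_epi _, le_antisymm ?_ ?_⟩
    · rintro _ ⟨x, rfl⟩
      exact LinearMap.congr_fun (congrArg lin S.zero) x
    · have h1 := h.exact.lift_f (kerι S.g) (kerι_comp S.g)
      intro x hx
      rw [← range_kerι] at hx
      obtain ⟨y, rfl⟩ := hx
      exact ⟨_, LinearMap.congr_fun (congrArg lin h1) y⟩
  · rintro ⟨h1, h2, h3⟩
    have := mono_of_injective _ h1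
    have := epi_of_surjective _ h2
    exact ⟨S.exact_of_f_is_kernel (isLimitOfInj S.f S.g S.zero h1 h3)⟩

/-- The trivial one-dimensional rational module `k`. -/
noncomputable def trivial (k : Type u) (A : Type v) [Field k] [CommRing A] [Bialgebra k A] :
    RationalModule.{u} k A where
  carrier := k
  coact := (TensorProduct.mk k k A).flip 1
  coassoc := by ext; simp [Algebra.TensorProduct.one_def]
  counit_coact := by ext; simp

end Category

section Restriction

variable {k : Type u} {A : Type v} {B : Type v'} [Field k] [CommRing A] [Bialgebra k A]
  [CommRing B] [Bialgebra k B]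

/-- Restriction of rational modules along a homomorphism `Spec B → Spec A` of affine group
schemes, given by its comorphism `φ : A → B`. -/
noncomputable def resObj (φ : A →ₐc[k] B) (M : RationalModule.{w} k A) :
    RationalModule.{w} k B where
  carrier := M.carrier
  coact := (φ : A →ₐ[k] B).toLinearMap.lTensor M.carrier ∘ₗ M.coact
  coassoc := by
    refine LinearMap.ext fun m => ?_
    have h1 : ∀ u : M.carrier ⊗[k] A, TensorProduct.assoc k M.carrier B B
        (((φ : A →ₐ[k] B).toLinearMap.lTensor M.carrier ∘ₗ M.coact).rTensor B
          ((φ : A →ₐ[k] B).toLinearMap.lTensor M.carrier u)) =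
        (TensorProduct.map (φ : A →ₐ[k] B).toLinearMap (φ : A →ₐ[k] B).toLinearMap).lTensor
          M.carrier (TensorProduct.assoc k M.carrier A A (M.coact.rTensor A u)) := by
      intro u
      induction u with
      | zero => simp
      | add a b ha hb => simp only [map_add, ha, hb]
      | tmul a b =>
        simp only [LinearMap.lTensor_tmul, LinearMap.rTensor_tmul, LinearMap.comp_apply]
        generalize M.coact a = w
        induction w with
        | zero => simp
        | add a b ha hb => simp only [map_add, TensorProduct.add_tmul, ha, hb]
        | tmul a b => simp
    have h2 : ∀ u : M.carrier ⊗[k] A, (Coalgebra.comul (R := k) (A := B)).lTensor M.carrier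
          ((φ : A →ₐ[k] B).toLinearMap.lTensor M.carrier u) =
        (TensorProduct.map (φ : A →ₐ[k] B).toLinearMap (φ : A →ₐ[k] B).toLinearMap).lTensor
          M.carrier ((Coalgebra.comul (R := k) (A := A)).lTensor M.carrier u) := by
      intro u
      induction u with
      | zero => simp
      | add a b ha hb => simp only [map_add, ha, hb]
      | tmul a b =>
        simp only [LinearMap.lTensor_tmul]
        congr 1
        exact (CoalgHomClass.map_comp_comul_apply φ b).symm
    refine (h1 _).trans ?_
    rw [coassoc_apply]
    exact (h2 _).symm
  counit_coact := by
    refine LinearMap.ext fun m => ?_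
    have h1 : ∀ u : M.carrier ⊗[k] A, (Coalgebra.counit (R := k) (A := B)).lTensor M.carrier
          ((φ : A →ₐ[k] B).toLinearMap.lTensor M.carrier u) =
        (Coalgebra.counit (R := k) (A := A)).lTensor M.carrier u := by
      intro u
      induction u with
      | zero => simp
      | add a b ha hb => simp only [map_add, ha, hb]
      | tmul a b => simp
    exact (congrArg _ (h1 _)).trans (counit_coact_apply M m)

/-- The restriction functor. -/
noncomputable def res (φ : A →ₐc[k] B) : RationalModule.{w} k A ⥤ RationalModule.{w} k B where
  obj M := resObj φ M
  map {M N} f := homMk (M := resObj φ M) (N := resObj φ N) (lin (M := M) (N := N) f) (by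
    have h : ∀ m : M.carrier, (φ : A →ₐ[k] B).toLinearMap.lTensor N.carrier (N.coact (lin f m)) =
        (lin f).rTensor B ((φ : A →ₐ[k] B).toLinearMap.lTensor M.carrier (M.coact m)) := by
      intro m
      rw [lin_comm]
      generalize M.coact m = u
      induction u with
      | zero => simp
      | add a b ha hb => simp only [map_add, ha, hb]
      | tmul a b => simp
    exact h)

instance (φ : A →ₐc[k] B) : (res.{u, v, v', w} φ).Additive where
  map_add {_ _ _ _} := hom_ext rfl

lemma res_map_shortExact (φ : A →ₐc[k] B) (S : ShortComplex (RationalModule.{w} k A))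
    (hS : S.ShortExact) : (S.map (res φ)).ShortExact :=
  (shortExact_iff _).2
    (show Function.Injective (lin S.f) ∧ Function.Surjective (lin S.g) ∧
      LinearMap.range (lin S.f) = LinearMap.ker (lin S.g) from (shortExact_iff S).1 hS)

instance (φ : A →ₐc[k] B) : PreservesFiniteLimits (res.{u, v, v', w} φ) :=
  have h : PreservesFiniteLimits (res.{u, v, v', w} φ) ∧ _ :=
    ((Functor.exact_tfae (res.{u, v, v', w} φ)).out 0 3).1 (res_map_shortExact.{u, v, v', w} φ)
  h.1

instance (φ : A →ₐc[k] B) : PreservesFiniteColimits (res.{u, v, v', w} φ) :=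
  have h : _ ∧ PreservesFiniteColimits (res.{u, v, v', w} φ) :=
    ((Functor.exact_tfae (res.{u, v, v', w} φ)).out 0 3).1 (res_map_shortExact.{u, v, v', w} φ)
  h.2

/-- The canonical identification of the restriction of the trivial module with the trivial
module (the identity map of `k`). -/
noncomputable def trivialToRes (φ : A →ₐc[k] B) : trivial k B ⟶ (res φ).obj (trivial k A) :=
  homMk (M := trivial k B) (N := resObj φ (trivial k A)) (LinearMap.id (M := k)) (by
    have h : ∀ m : k, (φ : A →ₐ[k] B).toLinearMap.lTensor k (m ⊗ₜ[k] (1 : A)) =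
        (LinearMap.id (R := k) (M := k)).rTensor B (m ⊗ₜ[k] (1 : B)) := by
      intro m
      simp
    exact h)

end Restriction

section Cohomology

open CategoryTheory.Abelian

variable {k : Type u} {A : Type v} {B : Type v'} [Field k] [CommRing A] [Bialgebra k A]
  [CommRing B] [Bialgebra k B]

/-- Ext groups exist (in a large enough universe) in the category of rational modules. -/
instance : HasExt.{max u v (u + 1)} (RationalModule.{u} k A) := HasExt.standard _

/-- The rational cohomology `Hⁿ(G, M) = Extⁿ_G(k, M)`, the Ext group being taken in the abelian
category of rational `G`-modules. -/
abbrev Cohomology (M : RationalModule.{u} k A) (n : ℕ) : Type (max u v (u + 1)) :=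
  Ext.{max u v (u + 1)} (trivial k A) M n

/-- The restriction map `Hⁿ(G, M) → Hⁿ(H, M)` for a homomorphism `H = Spec B → G = Spec A`:
the map `Extⁿ_G(k, M) → Extⁿ_H(k, M)` induced by the exact restriction functor. -/
noncomputable def cohomologyRes (φ : A →ₐc[k] B) (M : RationalModule.{u} k A) (n : ℕ) :
    Cohomology M n →+ Cohomology ((res φ).obj M) n where
  toFun x := (Ext.mk₀ (trivialToRes φ)).comp (x.mapExactFunctor (res φ)) (zero_add n)
  map_zero' := by simp
  map_add' x y := by simp

end Cohomology

end RationalModule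

/-! Write `H` for `G_S`. Since `H` contains all of `G₀`, the scheme `G` is a disjoint union of
translates `t H` by rational points `t = (1, t)`, with `t` running over representatives of the left
cosets of `π_S` in `π`. The number of translates is the index of a Sylow subgroup, hence invertible
in `k`. This permits the classical transfer argument: if `m` is an `H`-invariant vector of a
`G`-module, then `∑ t m` is `G`-invariant, and on a vector that is already `G`-invariant this sum is
multiplication by the index.

The passage to higher cohomology is by dimension shifting. The coaction embeds `M` in the cofree
module `J = M ⊗ k[G]`, with cokernel `N`. The module `J` is injective over `G`, and its restriction
is injective over `H`, because `k[G]` splits over `H` into copies of `k[H]`, one for each translate.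
A class of degree `n + 1` is therefore `δ y` with `y` of degree `n` over `N`. If it restricts to
zero, the restriction of `y` lifts to the cohomology of `J` over `H`. For `n > 0` that group
vanishes and induction gives `y = 0`. For `n = 0` the lift is an `H`-invariant vector of `J`; its
averaged transfer is a `G`-invariant lift of `y`, so `δ y = 0`.

Two notions carry this: `IsCofreeSplitting`, which implies injectivity and survives restriction
(`IsCofreeSplitting.res`), and `IsTransversal`, which is all that the argument uses about `H` in
`G`. The first is phrased by linear maps, so that `V ⊗ k[G]` need not be an object of the category,
whose universe is fixed. -/

namespace RationalModule

open CategoryTheory CategoryTheory.Limits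

/-! ### Cofree modules and injectivity -/

section Cofree

variable {k : Type u} {A : Type v} [Field k] [CommRing A] [Bialgebra k A]

/-- `p` and `q` exhibit the rational module `N` as a direct summand of the cofree rational module
`V ⊗ k[G]`: the morphism `q` is a retraction of the morphism `N → V ⊗ k[G]` corresponding to the
linear map `p`. -/
structure IsCofreeSplitting (N : RationalModule.{w} k A) {V : Type*} [AddCommGroup V] [Module k V]
    (p : N.carrier →ₗ[k] V) (q : V ⊗[k] A →ₗ[k] N.carrier) : Prop where
  colinear : ∀ v a, N.coact (q (v ⊗ₜ a)) =
    q.rTensor A ((TensorProduct.assoc k V A A).symm (v ⊗ₜ Coalgebra.comul (R := k) a))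
  retract : ∀ n, q (p.rTensor A (N.coact n)) = n

lemma IsCofreeSplitting.coact_apply {N : RationalModule.{w} k A} {V : Type*} [AddCommGroup V]
    [Module k V] {p : N.carrier →ₗ[k] V} {q : V ⊗[k] A →ₗ[k] N.carrier}
    (h : N.IsCofreeSplitting p q) (x : V ⊗[k] A) :
    N.coact (q x) = q.rTensor A ((TensorProduct.assoc k V A A).symm
      ((Coalgebra.comul (R := k) (A := A)).lTensor V x)) := by
  induction x with
  | zero => simp
  | add a b ha hb => simp only [map_add, ha, hb]
  | tmul a b => rw [h.colinear, LinearMap.lTensor_tmul]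

lemma rTensor_assoc_symm {X V : Type*} [AddCommGroup X] [Module k X] [AddCommGroup V] [Module k V]
    (g : X →ₗ[k] V) (x : X ⊗[k] (A ⊗[k] A)) :
    (TensorProduct.assoc k V A A).symm (g.rTensor (A ⊗[k] A) x) =
      (g.rTensor A).rTensor A ((TensorProduct.assoc k X A A).symm x) := by
  induction x with
  | zero => simp
  | add a b ha hb => simp only [map_add, ha, hb]
  | tmul a b =>
    induction b with
    | zero => simp
    | add b c hb hc => simp only [map_add, TensorProduct.tmul_add, hb, hc]
    | tmul b c => simp

lemma lTensor_rTensor_comm {X V W W' : Type*} [AddCommGroup X] [Module k X] [AddCommGroup V]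
    [Module k V] [AddCommGroup W] [Module k W] [AddCommGroup W'] [Module k W']
    (g : X →ₗ[k] V) (f : W →ₗ[k] W') (x : X ⊗[k] W) :
    f.lTensor V (g.rTensor W x) = g.rTensor W' (f.lTensor X x) := by
  rw [← LinearMap.comp_apply, ← LinearMap.comp_apply, LinearMap.lTensor_comp_rTensor,
    LinearMap.rTensor_comp_lTensor]

/-- A direct summand of a cofree rational module is injective. -/
lemma IsCofreeSplitting.injective {N : RationalModule.{w} k A} {V : Type*} [AddCommGroup V]
    [Module k V] {p : N.carrier →ₗ[k] V} {q : V ⊗[k] A →ₗ[k] N.carrier}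
    (h : N.IsCofreeSplitting p q) : Injective N where
  factors {X Y} f i _ := by
    -- Over a field, `i` has a linear retraction `r`. The linear map `p ∘ f ∘ r : Y → V` induces a
    -- colinear map `Y → V ⊗ k[G]`, which `q` carries to `N`.
    obtain ⟨r, hr⟩ := (lin i).exists_leftInverse_of_injective
      (LinearMap.ker_eq_bot.2 (injective_of_mono i))
    have hg : (lin f).comp r ∘ₗ lin i = lin f := by
      rw [LinearMap.comp_assoc, hr, LinearMap.comp_id]
    refine ⟨homMk (q ∘ₗ (p ∘ₗ (lin f).comp r).rTensor A ∘ₗ Y.coact) fun y => ?_, ?_⟩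
    · simp only [LinearMap.comp_apply]
      rw [h.coact_apply, lTensor_rTensor_comm, rTensor_assoc_symm, ← coassoc_apply,
        LinearEquiv.symm_apply_apply, ← LinearMap.rTensor_comp_apply, ← LinearMap.rTensor_comp_apply]
      rfl
    -- On the image of `i` the map `f ∘ r` is `f` itself, which is colinear, so `retract` applies.
    · refine hom_ext (LinearMap.ext fun x => ?_)
      simp only [lin_comp, lin_homMk, LinearMap.comp_apply]
      rw [lin_comm, ← LinearMap.rTensor_comp_apply, LinearMap.comp_assoc, hg,
        LinearMap.rTensor_comp_apply, ← lin_comm, h.retract]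

/-- The cofree rational module `V ⊗ k[G]`, with `k[G]` replaced by an isomorphic vector space `W`
in order to control universes. -/
noncomputable def cofree (V : Type w) [AddCommGroup V] [Module k V] {W : Type w} [AddCommGroup W]
    [Module k W] (e : W ≃ₗ[k] A) : RationalModule.{w} k A where
  carrier := V ⊗[k] W
  coact := (TensorProduct.assoc k V W A).symm.toLinearMap ∘ₗ
    (e.symm.toLinearMap.rTensor A ∘ₗ Coalgebra.comul (R := k) (A := A) ∘ₗ
      e.toLinearMap).lTensor V
  coassoc := by
    refine TensorProduct.ext' fun v x => ?_
    simp only [LinearMap.comp_apply, LinearMap.lTensor_tmul, LinearEquiv.coe_coe]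
    -- With `y = Δ (e x)`, the identities `h1` and `h2` write the two sides as the two iterated
    -- comultiplications of `e x`, so that only coassociativity of `k[G]` remains.
    have h1 : ∀ y : A ⊗[k] A, TensorProduct.assoc k (V ⊗[k] W) A A
        (((TensorProduct.assoc k V W A).symm.toLinearMap ∘ₗ
          (e.symm.toLinearMap.rTensor A ∘ₗ Coalgebra.comul (R := k) (A := A) ∘ₗ
            e.toLinearMap).lTensor V).rTensor A
          ((TensorProduct.assoc k V W A).symm (v ⊗ₜ e.symm.toLinearMap.rTensor A y))) =
        (TensorProduct.assoc k V W (A ⊗[k] A)).symm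
          (v ⊗ₜ e.symm.toLinearMap.rTensor (A ⊗[k] A) (TensorProduct.assoc k A A A
            ((Coalgebra.comul (R := k) (A := A)).rTensor A y))) := by
      intro y
      induction y with
      | zero => simp
      | add a b ha hb => simp only [map_add, TensorProduct.tmul_add, ha, hb]
      | tmul a b =>
        simp only [LinearMap.rTensor_tmul, TensorProduct.assoc_symm_tmul, LinearMap.comp_apply,
          LinearMap.lTensor_tmul, LinearEquiv.coe_coe, LinearEquiv.apply_symm_apply]
        generalize Coalgebra.comul (R := k) a = z
        induction z with
        | zero => simp
        | add a b ha hb => simp only [map_add, TensorProduct.tmul_add, TensorProduct.add_tmul, ha, hb]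
        | tmul a b => simp
    have h2 : ∀ y : A ⊗[k] A, (Coalgebra.comul (R := k) (A := A)).lTensor (V ⊗[k] W)
        ((TensorProduct.assoc k V W A).symm (v ⊗ₜ e.symm.toLinearMap.rTensor A y)) =
        (TensorProduct.assoc k V W (A ⊗[k] A)).symm
          (v ⊗ₜ e.symm.toLinearMap.rTensor (A ⊗[k] A)
            ((Coalgebra.comul (R := k) (A := A)).lTensor A y)) := by
      intro y
      induction y with
      | zero => simp
      | add a b ha hb => simp only [map_add, TensorProduct.tmul_add, ha, hb]
      | tmul a b => simp
    rw [h1, h2, Coalgebra.coassoc_apply]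
  counit_coact := by
    refine TensorProduct.ext' fun v x => ?_
    have h1 : ∀ y : A ⊗[k] A, TensorProduct.rid k (V ⊗[k] W)
        ((Coalgebra.counit (R := k) (A := A)).lTensor (V ⊗[k] W)
        ((TensorProduct.assoc k V W A).symm (v ⊗ₜ e.symm.toLinearMap.rTensor A y))) =
        v ⊗ₜ e.symm (TensorProduct.rid k A
            ((Coalgebra.counit (R := k) (A := A)).lTensor A y)) := by
      intro y
      induction y with
      | zero => simp
      | add a b ha hb => simp only [map_add, TensorProduct.tmul_add, ha, hb]
      | tmul a b => simp
    simp only [LinearMap.comp_apply, LinearMap.lTensor_tmul, LinearEquiv.coe_coe, LinearMap.id_apply]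
    rw [h1, Coalgebra.lTensor_counit_comul]
    simp

lemma cofree_coact_tmul {V W : Type w} [AddCommGroup V] [Module k V] [AddCommGroup W]
    [Module k W] (e : W ≃ₗ[k] A) (v : V) (x : W) :
    (cofree V e).coact (v ⊗ₜ[k] x : V ⊗[k] W) = (TensorProduct.assoc k V W A).symm
      (v ⊗ₜ e.symm.toLinearMap.rTensor A (Coalgebra.comul (R := k) (e x))) := rfl

/-- The counit on the second factor corresponds to the identification `V ⊗ W ≃ V ⊗ k[G]` given by
`e`, whose inverse is the retraction. The retraction identity is the left counit axiom. -/
lemma cofree_isCofreeSplitting {V W : Type w} [AddCommGroup V] [Module k V] [AddCommGroup W]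
    [Module k W] (e : W ≃ₗ[k] A) :
    (cofree V e).IsCofreeSplitting (V := V)
      ((TensorProduct.rid k V).toLinearMap ∘ₗ
        (Coalgebra.counit (R := k) (A := A) ∘ₗ e.toLinearMap).lTensor V)
      (e.symm.toLinearMap.lTensor V) where
  colinear v a := by
    refine (cofree_coact_tmul e v (e.symm a)).trans ?_
    rw [LinearEquiv.apply_symm_apply]
    generalize Coalgebra.comul (R := k) a = z
    change _ = ((e.symm.toLinearMap.lTensor V).rTensor A) ((TensorProduct.assoc k V A A).symm (v ⊗ₜ z))
    induction z with
    | zero => simp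
    | add a b ha hb => simp only [map_add, TensorProduct.tmul_add, ha, hb]
    | tmul a b => simp
  retract n := by
    have h1 : ∀ (v : V) (y : A ⊗[k] A), e.symm.toLinearMap.lTensor V
        (((TensorProduct.rid k V).toLinearMap ∘ₗ
        (Coalgebra.counit (R := k) (A := A) ∘ₗ e.toLinearMap).lTensor V).rTensor A
        ((TensorProduct.assoc k V W A).symm (v ⊗ₜ e.symm.toLinearMap.rTensor A y))) =
        v ⊗ₜ e.symm (TensorProduct.lid k A
            ((Coalgebra.counit (R := k) (A := A)).rTensor A y)) := by
      intro v y
      induction y with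
      | zero => simp
      | add a b ha hb => simp only [map_add, TensorProduct.tmul_add, ha, hb]
      | tmul a b => simp [TensorProduct.smul_tmul]
    change V ⊗[k] W at n
    induction n with
    | zero => exact (congrArg _ (congrArg _ (map_zero _))).trans (by rw [map_zero]; exact map_zero _)
    | add a b ha hb =>
      refine Eq.trans ?_ (congrArg₂ _ ha hb)
      refine (congrArg _ (congrArg _ (map_add (cofree V e).coact a b))).trans ?_
      rw [map_add]
      exact map_add _ _ _
    | tmul v x =>
      refine (h1 v (Coalgebra.comul (R := k) (e x))).trans ?_
      rw [Coalgebra.rTensor_counit_comul]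
      simp

/-- The coaction of `M`, as a morphism to a cofree module. -/
noncomputable def toCofree (M : RationalModule.{w} k A) {W : Type w} [AddCommGroup W]
    [Module k W] (e : W ≃ₗ[k] A) : M ⟶ cofree M.carrier e :=
  homMk (N := cofree M.carrier e) (e.symm.toLinearMap.lTensor M.carrier ∘ₗ M.coact) fun m => by
    -- Up to `e`, colinearity of the coaction as a map into the cofree module is coassociativity of
    -- `M`.
    have h1 : ∀ y : M.carrier ⊗[k] A,
        (cofree M.carrier e).coact (e.symm.toLinearMap.lTensor M.carrier y) =
        (e.symm.toLinearMap.lTensor M.carrier).rTensor A ((TensorProduct.assoc k _ _ _).symm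
          ((Coalgebra.comul (R := k) (A := A)).lTensor M.carrier y)) :=
      fun y => (cofree_isCofreeSplitting e).coact_apply y
    refine (h1 _).trans ?_
    rw [← coassoc_apply, LinearEquiv.symm_apply_apply]
    exact (LinearMap.rTensor_comp_apply _ _ _ _).symm

/-- The counit axiom gives a linear left inverse of the coaction. -/
lemma toCofree_injective (M : RationalModule.{w} k A) {W : Type w} [AddCommGroup W]
    [Module k W] (e : W ≃ₗ[k] A) : Function.Injective (lin (M.toCofree e)) := by
  have h : Function.Injective M.coact := fun x y h => by
    rw [← counit_coact_apply M x, h, counit_coact_apply]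
  exact ((LinearEquiv.lTensor M.carrier e.symm).injective.comp h :)

end Cofree

/-! ### Transversals, restriction of cofree modules, and the transfer -/

section Transversal

variable {k : Type u} {A : Type v} {B : Type v'} [Field k] [CommRing A] [Bialgebra k A]
  [CommRing B] [Bialgebra k B]

/-- A transversal of the subgroup scheme `H = Spec B` in `G = Spec A`, where `φ : A → B` is the
comorphism of the inclusion: `G` is the disjoint union of the translates `t H` for a finite family
of rational points `t`. Here `ε t` is evaluation at the point `t`, and `ι t` sends a function `f`
on `H` to the function on `G` that vanishes outside of `t H` and is `t h ↦ f h` on `t H`. -/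
structure IsTransversal (φ : A →ₐc[k] B) {T : Type*} [Fintype T] (ε : T → A →ₗ[k] k)
    (ι : T → B →ₗ[k] A) : Prop where
  colinear : ∀ t b, (φ : A →ₐ[k] B).toLinearMap.lTensor A (Coalgebra.comul (R := k) (ι t b)) =
    (ι t).rTensor B (Coalgebra.comul (R := k) b)
  sum_eq : ∀ a, ∑ t, ι t (TensorProduct.lid k B (TensorProduct.map (ε t)
    (φ : A →ₐ[k] B).toLinearMap (Coalgebra.comul (R := k) a))) = a
  sum_translate : ∀ t, ∑ s, TensorProduct.rid k A
    ((ε s).lTensor A (Coalgebra.comul (R := k) (ι t 1))) = 1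
  apply_one : ∀ t, ε t 1 = 1

variable {φ : A →ₐc[k] B} {T : Type*} [Fintype T] {ε : T → A →ₗ[k] k} {ι : T → B →ₗ[k] A}

/-- The action of a linear functional on `k[G]` (for instance, of a rational point) on a rational
`G`-module. -/
noncomputable def act (M : RationalModule.{w} k A) (l : A →ₗ[k] k) : M.carrier →ₗ[k] M.carrier :=
  (TensorProduct.rid k M.carrier).toLinearMap ∘ₗ l.lTensor M.carrier ∘ₗ M.coact

lemma act_apply (M : RationalModule.{w} k A) (l : A →ₗ[k] k) (m : M.carrier) :
    M.act l m = TensorProduct.rid k M.carrier (l.lTensor M.carrier (M.coact m)) := rfl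

lemma lin_act {M N : RationalModule.{w} k A} (f : M ⟶ N) (l : A →ₗ[k] k) (m : M.carrier) :
    lin f (M.act l m) = N.act l (lin f m) := by
  rw [act_apply, act_apply, lin_comm, lTensor_rTensor_comm]
  generalize l.lTensor M.carrier (M.coact m) = z
  induction z with
  | zero => simp
  | add a b ha hb => simp only [map_add, ha, hb]
  | tmul a b => simp

/-- This is `sum_eq` tensored with `M`: a function on `G` with values in `M` is the sum of its
pieces on the translates `t H`. -/
lemma IsTransversal.sum_act (h : IsTransversal φ ε ι) (M : RationalModule.{w} k A)
    (z : M.carrier ⊗[k] A) :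
    ∑ t, (ι t ∘ₗ (TensorProduct.lid k B).toLinearMap ∘ₗ TensorProduct.map (ε t)
      (φ : A →ₐ[k] B).toLinearMap ∘ₗ Coalgebra.comul (R := k)).lTensor M.carrier z = z := by
  induction z with
  | zero => simp
  | add a b ha hb => simp only [map_add, Finset.sum_add_distrib, ha, hb]
  | tmul m a =>
    simp only [LinearMap.lTensor_tmul, ← TensorProduct.tmul_sum]
    congr 1
    exact h.sum_eq a

/-- The dual form of `(t h) m = t (h m)`: for `l` evaluation at `t`, the left side restricts `g ↦ g
m` to `t H` and the right side is `h ↦ t (h m)`, both then carried to `G` by `j`. Coassociativity of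
`M` identifies them. -/
lemma lTensor_act (φ : A →ₐc[k] B) (l : A →ₗ[k] k) (j : B →ₗ[k] A) (M : RationalModule.{w} k A)
    (m : M.carrier) :
    (j ∘ₗ (TensorProduct.lid k B).toLinearMap ∘ₗ TensorProduct.map l
      (φ : A →ₐ[k] B).toLinearMap ∘ₗ Coalgebra.comul (R := k)).lTensor M.carrier (M.coact m) =
    j.lTensor M.carrier ((M.act l).rTensor B ((resObj φ M).coact m)) := by
  have h1 : ∀ z : M.carrier ⊗[k] (A ⊗[k] A), (j ∘ₗ (TensorProduct.lid k B).toLinearMap ∘ₗ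
      TensorProduct.map l (φ : A →ₐ[k] B).toLinearMap).lTensor M.carrier z =
      j.lTensor M.carrier (((TensorProduct.rid k M.carrier).toLinearMap ∘ₗ
        l.lTensor M.carrier).rTensor B ((φ : A →ₐ[k] B).toLinearMap.lTensor (M.carrier ⊗[k] A)
        ((TensorProduct.assoc k M.carrier A A).symm z))) := by
    intro z
    induction z with
    | zero => simp
    | add a b ha hb => simp only [map_add, ha, hb]
    | tmul a b =>
      induction b with
      | zero => simp
      | add b c hb hc => simp only [map_add, TensorProduct.tmul_add, hb, hc]
      | tmul b c => simp [TensorProduct.smul_tmul]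
  have h2 := h1 ((Coalgebra.comul (R := k) (A := A)).lTensor M.carrier (M.coact m))
  rw [← LinearMap.lTensor_comp_apply, ← coassoc_apply, LinearEquiv.symm_apply_apply,
    lTensor_rTensor_comm M.coact, ← LinearMap.rTensor_comp_apply] at h2
  exact h2

/-- The reconstruction of the coaction of `G` from the coaction of `H` and a transversal. -/
lemma IsTransversal.coact_eq (h : IsTransversal φ ε ι) (M : RationalModule.{w} k A)
    (m : M.carrier) :
    M.coact m = ∑ t, (ι t).lTensor M.carrier
      ((M.act (ε t)).rTensor B ((resObj φ M).coact m)) := by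
  rw [← h.sum_act M (M.coact m)]
  exact Finset.sum_congr rfl fun t _ => lTensor_act φ (ε t) (ι t) M m

/-- The restriction of a direct summand of a cofree module to a subgroup with a transversal is
a direct summand of a cofree module. -/
lemma IsCofreeSplitting.res (h : IsTransversal φ ε ι) {N : RationalModule.{w} k A} {V : Type*}
    [AddCommGroup V] [Module k V] {p : N.carrier →ₗ[k] V} {q : V ⊗[k] A →ₗ[k] N.carrier}
    (hN : N.IsCofreeSplitting p q) :
    (resObj φ N).IsCofreeSplitting (V := T → V) (LinearMap.pi fun t => p ∘ₗ N.act (ε t))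
      (∑ t, q ∘ₗ TensorProduct.map (LinearMap.proj t) (ι t)) where
  colinear f b := by
    have h0 : ∀ (x : V) (z : A ⊗[k] A), (φ : A →ₐ[k] B).toLinearMap.lTensor N.carrier
        (q.rTensor A ((TensorProduct.assoc k V A A).symm (x ⊗ₜ z))) =
        q.rTensor B ((TensorProduct.assoc k V A B).symm
          (x ⊗ₜ (φ : A →ₐ[k] B).toLinearMap.lTensor A z)) := by
      intro x z
      induction z with
      | zero => simp
      | add a b ha hb => simp only [map_add, TensorProduct.tmul_add, ha, hb]
      | tmul a b => simp
    -- Each summand is colinear over `H`: `q` is colinear over `G`, and `ι t` over `H` because right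
    -- translation by `H` preserves `t H`.
    have h1 : ∀ t, (resObj φ N).coact (q (f t ⊗ₜ ι t b)) =
        q.rTensor B ((TensorProduct.assoc k V A B).symm
          (f t ⊗ₜ (ι t).rTensor B (Coalgebra.comul (R := k) b))) := by
      intro t
      refine (congrArg ((φ : A →ₐ[k] B).toLinearMap.lTensor N.carrier)
        (hN.colinear (f t) (ι t b))).trans ?_
      rw [h0, h.colinear]
    have h2 : ∀ z : B ⊗[k] B, (∑ t, q ∘ₗ TensorProduct.map (LinearMap.proj t) (ι t)).rTensor B
        ((TensorProduct.assoc k (T → V) B B).symm (f ⊗ₜ z)) =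
        ∑ t, q.rTensor B ((TensorProduct.assoc k V A B).symm (f t ⊗ₜ (ι t).rTensor B z)) := by
      intro z
      induction z with
      | zero => simp
      | add a b ha hb => simp only [map_add, TensorProduct.tmul_add, ha, hb, Finset.sum_add_distrib]
      | tmul a b => simp [TensorProduct.sum_tmul]
    refine Eq.trans ?_ (h2 _).symm
    simp only [LinearMap.coe_sum, Finset.sum_apply]
    refine (map_sum (resObj φ N).coact _ _).trans (Finset.sum_congr rfl fun t _ => h1 t)
  retract n := by
    -- The composite through `V^T ⊗ k[H]` reassembles the coaction of `G` from its pieces on the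
    -- translates, by `coact_eq`; the original retraction then applies.
    have h1 : ∀ z : N.carrier ⊗[k] B, (∑ t, q ∘ₗ TensorProduct.map (LinearMap.proj t) (ι t))
        ((LinearMap.pi fun t => p ∘ₗ N.act (ε t)).rTensor B z) =
        q (p.rTensor A (∑ t, (ι t).lTensor N.carrier ((N.act (ε t)).rTensor B z))) := by
      intro z
      induction z with
      | zero => simp
      | add a b ha hb => simp only [map_add, Finset.sum_add_distrib, ha, hb]
      | tmul a b => simp
    refine (h1 _).trans ?_
    exact (congrArg (fun x => q (p.rTensor A x)) (h.coact_eq N n).symm).trans (hN.retract n)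

/-- The sum of the translates of an `H`-invariant vector is `G`-invariant. -/
lemma IsTransversal.coact_sum_act (h : IsTransversal φ ε ι) (M : RationalModule.{w} k A)
    (m : M.carrier) (hm : (resObj φ M).coact m = m ⊗ₜ[k] (1 : B)) :
    M.coact (∑ t, M.act (ε t) m) = (∑ t, M.act (ε t) m) ⊗ₜ[k] (1 : A) := by
  -- The dual form of `g (s x) = (g s) x`, with `l` in place of the point `s`: acting on a vector
  -- right-translates its coefficient functions.
  have h1 : ∀ (l : A →ₗ[k] k) (x : M.carrier), M.coact (M.act l x) =
      ((TensorProduct.rid k A).toLinearMap ∘ₗ l.lTensor A ∘ₗ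
        Coalgebra.comul (R := k)).lTensor M.carrier (M.coact x) := by
    intro l x
    have h2 : ∀ z : M.carrier ⊗[k] A,
        M.coact (TensorProduct.rid k M.carrier (l.lTensor M.carrier z)) =
        ((TensorProduct.rid k A).toLinearMap ∘ₗ l.lTensor A).lTensor M.carrier
          (TensorProduct.assoc k M.carrier A A (M.coact.rTensor A z)) := by
      intro z
      induction z with
      | zero => simp
      | add a b ha hb => simp only [map_add, ha, hb]
      | tmul a b =>
        simp only [LinearMap.lTensor_tmul, TensorProduct.rid_tmul, map_smul, LinearMap.rTensor_tmul]
        generalize M.coact a = y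
        induction y with
        | zero => simp
        | add a b ha hb => simp only [map_add, smul_add, TensorProduct.add_tmul, ha, hb]
        | tmul a b => simp
    rw [act_apply, h2, coassoc_apply, ← LinearMap.lTensor_comp_apply]
    rfl
  -- For an `H`-invariant `m`, the function `g ↦ g m` is constant, equal to `t m`, on `t H`; here `ι
  -- t 1` is the indicator function of `t H`.
  have h3 : M.coact m = ∑ t, M.act (ε t) m ⊗ₜ[k] ι t 1 := by
    rw [h.coact_eq M m, hm]
    simp
  rw [map_sum]
  simp only [h1]
  rw [h3]
  simp only [map_sum, LinearMap.lTensor_tmul]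
  -- For fixed `t`, the coefficient of `t m` is the sum over `s` of the functions `g ↦ 1_{tH}(g s)`.
  -- It equals `1`, since `g` permutes the translates.
  rw [Finset.sum_comm, TensorProduct.sum_tmul]
  refine Finset.sum_congr rfl fun t _ => ?_
  rw [← TensorProduct.tmul_sum]
  congr 1
  exact h.sum_translate t

lemma IsTransversal.act_of_coact_eq (h : IsTransversal φ ε ι) (M : RationalModule.{w} k A)
    (m : M.carrier) (hm : M.coact m = m ⊗ₜ[k] (1 : A)) (t : T) : M.act (ε t) m = m := by
  rw [act_apply, hm]
  simp [h.apply_one]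

/-- The transfer `Hom_H(k, M) → Hom_G(k, M)`. -/
noncomputable def IsTransversal.transfer (h : IsTransversal φ ε ι) {M : RationalModule.{u} k A}
    (z : trivial k B ⟶ (RationalModule.res φ).obj M) : trivial k A ⟶ M :=
  homMk (M := trivial k A) (LinearMap.toSpanSingleton k M.carrier
    (∑ t, M.act (ε t) (lin z (1 : k)))) fun c => by
    have h1 : (resObj φ M).coact (lin z (1 : k)) = lin z (1 : k) ⊗ₜ[k] (1 : B) :=
      lin_comm z (1 : k)
    change k at c
    have h2 := h.coact_sum_act M _ h1
    change M.coact (c • (∑ t, M.act (ε t) (lin z (1 : k)))) =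
      (c • (∑ t, M.act (ε t) (lin z (1 : k)))) ⊗ₜ[k] (1 : A)
    rw [map_smul, h2, TensorProduct.smul_tmul']

end Transversal

/-! ### Dimension shifting -/

section Injectivity

open CategoryTheory.Abelian

variable {k : Type u} {A : Type v} {B : Type v'} [Field k] [CommRing A] [Bialgebra k A]
  [CommRing B] [Bialgebra k B] {φ : A →ₐc[k] B} {T : Type*} [Fintype T] {ε : T → A →ₗ[k] k}
  {ι : T → B →ₗ[k] A}

/-- If the restriction of an invariant vector of `N` to `H` lifts to an `H`-invariant vector
of `J`, and the index of `H` is invertible in `k`, then the vector lifts to a `G`-invariant vector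
of `J`. -/
lemma IsTransversal.exists_lift (h : IsTransversal φ ε ι) (hT : (Fintype.card T : k) ≠ 0)
    {J N : RationalModule.{u} k A} (g : J ⟶ N) (y : trivial k A ⟶ N)
    (z : trivial k B ⟶ (res φ).obj J)
    (hz : z ≫ (res φ).map g = trivialToRes φ ≫ (res φ).map y) :
    ∃ y' : trivial k A ⟶ J, y' ≫ g = y := by
  let m : J.carrier := lin z (1 : k)
  have hy : lin g m = lin y (1 : k) := LinearMap.congr_fun (congrArg lin hz) (1 : k)
  have hy' : N.coact (lin y (1 : k)) = lin y (1 : k) ⊗ₜ[k] (1 : A) := lin_comm y (1 : k)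
  -- Coactions are linear, so a morphism may be divided by `|T|`. The lift is the average of the
  -- translates of `m`.
  have hscale : ∀ {X Y : RationalModule.{u} k A} (f : X ⟶ Y) (m : X.carrier),
      Y.coact (((Fintype.card T : k)⁻¹ • lin f) m) =
        ((Fintype.card T : k)⁻¹ • lin f).rTensor A (X.coact m) := by
    intro X Y f m
    simp [lin_comm, LinearMap.rTensor_smul]
  refine ⟨homMk _ (hscale (h.transfer z)), hom_ext (LinearMap.ext_ring ?_)⟩
  -- Each translate of `m` maps to the same translate of `y(1)`, which is `y(1)` by `G`-invariance.
  have h1 : lin g (∑ t, J.act (ε t) m) = (Fintype.card T : k) • lin y (1 : k) := by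
    simp only [map_sum, lin_act, hy, h.act_of_coact_eq N _ hy']
    rw [Finset.sum_const, Finset.card_univ, Nat.cast_smul_eq_nsmul]
  change lin g ((Fintype.card T : k)⁻¹ • ((1 : k) • ∑ t, J.act (ε t) m)) = _
  rw [one_smul, map_smul, h1, inv_smul_smul₀ hT]
  rfl

/-- Restriction in cohomology to a subgroup scheme with a transversal whose cardinality is
invertible in `k` is injective. -/
theorem IsTransversal.cohomologyRes_injective [Module.Finite k A] (h : IsTransversal φ ε ι)
    (hT : (Fintype.card T : k) ≠ 0) (M : RationalModule.{u} k A) (n : ℕ) :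
    Function.Injective (cohomologyRes φ M n) := by
  rw [injective_iff_map_eq_zero]
  -- `M` must vary, since the shift replaces it by the cokernel `S.X₃`.
  induction n generalizing M with
  | zero =>
    intro x hx
    obtain ⟨f, rfl⟩ := (Ext.mk₀_bijective _ _).2 x
    change (Ext.mk₀ (trivialToRes φ)).comp ((Ext.mk₀ f).mapExactFunctor (res φ)) (zero_add 0) = 0 at hx
    rw [Ext.mapExactFunctor_mk₀, Ext.mk₀_comp_mk₀, Ext.mk₀_eq_zero_iff] at hx
    rw [Ext.mk₀_eq_zero_iff]
    -- In degree zero, restriction does not change the underlying linear map.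
    exact hom_ext (LinearMap.ext fun c => LinearMap.congr_fun (congrArg lin hx) c)
  | succ n ih =>
    intro x hx
    -- Finite dimensionality replaces `k[G]` by a power of `k`, so that the cofree module lies in
    -- the same universe as `M`.
    let e : (Fin (Module.finrank k A) → k) ≃ₗ[k] A := (Module.finBasis k A).equivFun.symm
    have hJ := cofree_isCofreeSplitting (V := M.carrier) e
    have : Injective (cofree M.carrier e) := hJ.injective
    have : Injective ((res φ).obj (cofree M.carrier e)) := (hJ.res h).injective
    let S : ShortComplex (RationalModule.{u} k A) :=
      ⟨M.toCofree e, cokerπ (M.toCofree e), comp_cokerπ _⟩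
    have hS : S.ShortExact := (shortExact_iff S).2
      ⟨M.toCofree_injective e, cokerπ_surjective _, (ker_cokerπ _).symm⟩
    -- The image of `x` in the cohomology of the injective `J` vanishes in positive degree, so `x =
    -- δ y`.
    obtain ⟨y, rfl⟩ := Ext.covariant_sequence_exact₁ _ hS x
      (Ext.eq_zero_of_injective (I := cofree M.carrier e) _) rfl
    -- Restriction is exact and commutes with connecting maps, so the restriction of `y` is killed
    -- by `δ` over `H` and lifts to a class `z` with values in `J`.
    have hres : (cohomologyRes φ S.X₃ n y).comp (hS.map_of_exact (res φ)).extClass rfl = 0 := by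
      refine Eq.trans ?_ hx
      change ((Ext.mk₀ (trivialToRes φ)).comp (y.mapExactFunctor (res φ)) (zero_add n)).comp _ _ =
        (Ext.mk₀ (trivialToRes φ)).comp ((y.comp hS.extClass rfl).mapExactFunctor (res φ))
          (zero_add (n + 1))
      rw [Ext.mapExactFunctor_comp, Ext.mapExactFunctor_extClass]
      exact Ext.comp_assoc _ _ _ (zero_add n) rfl (by omega)
    obtain ⟨z, hz⟩ := Ext.covariant_sequence_exact₃ _ (hS.map_of_exact (res φ)) _ rfl hres
    cases n with
    | zero =>
      obtain ⟨z, rfl⟩ := (Ext.mk₀_bijective _ _).2 z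
      obtain ⟨y, rfl⟩ := (Ext.mk₀_bijective _ _).2 y
      change _ = (Ext.mk₀ (trivialToRes φ)).comp ((Ext.mk₀ y).mapExactFunctor (res φ)) (zero_add 0) at hz
      rw [Ext.mapExactFunctor_mk₀, Ext.mk₀_comp_mk₀, Ext.mk₀_comp_mk₀] at hz
      -- The restricted `J` may have nonzero invariants, so `z` need not vanish here. The transfer
      -- turns it into a lift `y'` of `y` over `G`, and `δ` kills what comes from `J`.
      obtain ⟨y', rfl⟩ := h.exists_lift hT S.g y z ((Ext.mk₀_bijective _ _).1 hz)
      rw [← Ext.mk₀_comp_mk₀, Ext.comp_assoc _ _ _ (zero_add 0) (zero_add 1) (by omega), hS.comp_extClass, Ext.comp_zero]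
    | succ n =>
      have hz0 : z = 0 := Ext.eq_zero_of_injective (I := (res φ).obj (cofree M.carrier e)) z
      rw [hz0, Ext.zero_comp] at hz
      rw [ih S.X₃ y hz.symm, Ext.zero_comp]

end Injectivity

end RationalModule

namespace GroupSchemeAction

/-! ### The coset transversal of a semidirect product -/

section Transversal

variable {k π A₀ : Type*} [Field k] [Group π] [CommRing A₀] [HopfAlgebra k A₀]
  (α : GroupSchemeAction k π A₀) (H : Subgroup π)

/-- Evaluation of functions on `G₀ ⋊ π` at the rational point `(1, t)`. -/
noncomputable def evalPoint (t : π) : α.SemidirectCoord →ₗ[k] k :=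
  Coalgebra.counit (R := k) ∘ₗ (α.component t).toLinearMap

open Classical in
/-- Transport of functions from `G₀ ⋊ H` to the coset `(1, t) (G₀ ⋊ H)`, followed by extension
by zero. -/
noncomputable def cosetExtend (t : π) :
    (α.restrict H).SemidirectCoord →ₗ[k] α.SemidirectCoord :=
  LinearMap.pi (φ := fun _ : π => A₀) fun x =>
    if h : t⁻¹ * x ∈ H then (α.comorphism t⁻¹ : A₀ →ₐ[k] A₀).toLinearMap ∘ₗ
      ((α.restrict H).component ⟨t⁻¹ * x, h⟩).toLinearMap
    else 0

lemma component_cosetExtend_of_mem {t x : π} (h : t⁻¹ * x ∈ H) :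
    (α.component x).toLinearMap ∘ₗ α.cosetExtend H t =
      (α.comorphism t⁻¹ : A₀ →ₐ[k] A₀).toLinearMap ∘ₗ
        ((α.restrict H).component ⟨t⁻¹ * x, h⟩).toLinearMap :=
  dif_pos h

lemma component_cosetExtend_of_notMem {t x : π} (h : t⁻¹ * x ∉ H) :
    (α.component x).toLinearMap ∘ₗ α.cosetExtend H t = 0 :=
  dif_neg h

lemma component_cosetExtend_apply_of_mem {t x : π} (h : t⁻¹ * x ∈ H)
    (F : (α.restrict H).SemidirectCoord) :
    α.component x (α.cosetExtend H t F) =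
      α.comorphism t⁻¹ ((α.restrict H).component ⟨t⁻¹ * x, h⟩ F) :=
  LinearMap.congr_fun (α.component_cosetExtend_of_mem H h) F

lemma component_cosetExtend_apply_of_notMem {t x : π} (h : t⁻¹ * x ∉ H)
    (F : (α.restrict H).SemidirectCoord) :
    α.component x (α.cosetExtend H t F) = 0 :=
  LinearMap.congr_fun (α.component_cosetExtend_of_notMem H h) F

/-- Dual to `y(g₁ · x(g₂)) = y(g₁) · (y x)(g₂)`. -/
lemma twistedComul_comorphism (x y : π) (a : A₀) :
    α.twistedComul x (α.comorphism y a) =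
      Algebra.TensorProduct.map (α.comorphism y : A₀ →ₐ[k] A₀) (AlgHom.id k A₀)
        (α.twistedComul (y * x) a) := by
  rw [twistedComul_apply, twistedComul_apply, comul_comorphism]
  generalize Coalgebra.comul (R := k) a = z
  induction z with
  | zero => simp
  | add a b ha hb => simp only [map_add, ha, hb]
  | tmul a b => simp [comorphism_mul_apply]

/-- Set `g₁ = 1` in `f (g₁ · x(g₂))`. -/
lemma rTensor_counit_twistedComul (x : π) (a : A₀) :
    TensorProduct.lid k A₀ ((Coalgebra.counit (R := k)).rTensor A₀ (α.twistedComul x a)) =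
      α.comorphism x a := by
  have h : ∀ z : A₀ ⊗[k] A₀, TensorProduct.lid k A₀ ((Coalgebra.counit (R := k)).rTensor A₀
      (Algebra.TensorProduct.map (AlgHom.id k A₀) (α.comorphism x : A₀ →ₐ[k] A₀) z)) =
      α.comorphism x (TensorProduct.lid k A₀ ((Coalgebra.counit (R := k)).rTensor A₀ z)) := by
    intro z
    induction z with
    | zero => simp
    | add a b ha hb => simp only [map_add, ha, hb]
    | tmul a b => simp
  rw [twistedComul_apply, h, Coalgebra.rTensor_counit_comul]
  simp

lemma out_inv_mul_mem_iff (t : π ⧸ H) (x : π) :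
    t.out⁻¹ * x ∈ H ↔ t = (x : π ⧸ H) := by
  rw [← QuotientGroup.eq, QuotientGroup.out_eq']

variable [Finite π]

lemma map_component_comul (x y : π) (F : α.SemidirectCoord) :
    TensorProduct.map (α.component x).toLinearMap (α.component y).toLinearMap
      (Coalgebra.comul (R := k) F) = α.twistedComul x (α.component (x * y) F) :=
  α.component_comulHom x y F

/-- Left translation by `t` commutes with right translation by `H`, and for `y ∈ H` the components
`x` and `x y` both lie in `t H` or both lie outside it. -/
lemma cosetExtend_colinear (t : π) (F : (α.restrict H).SemidirectCoord) :
    (α.restrictCoord H : α.SemidirectCoord →ₐ[k] _).toLinearMap.lTensor α.SemidirectCoord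
      (Coalgebra.comul (R := k) (α.cosetExtend H t F)) =
    (α.cosetExtend H t).rTensor _ (Coalgebra.comul (R := k) F) := by
  refine α.rTensor_ext fun x => (α.restrict H).lTensor_ext fun y => ?_
  have h1 : ((α.restrict H).component y).toLinearMap ∘ₗ
      (α.restrictCoord H : α.SemidirectCoord →ₐ[k] _).toLinearMap =
      (α.component (y : π)).toLinearMap := rfl
  simp only [← LinearMap.comp_apply, ← LinearMap.comp_assoc, ← LinearMap.rTensor_comp]
  simp only [← TensorProduct.map_comp, LinearMap.rTensor,
    LinearMap.lTensor, LinearMap.comp_id, LinearMap.id_comp, h1]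
  simp only [LinearMap.comp_apply]
  rw [map_component_comul]
  by_cases h : t⁻¹ * x ∈ H
  · have h' : t⁻¹ * (x * y) ∈ H := by
      rw [← mul_assoc]
      exact H.mul_mem h y.2
    rw [component_cosetExtend_of_mem _ _ h, component_cosetExtend_apply_of_mem _ _ h',
      twistedComul_comorphism]
    have h2 := (α.restrict H).map_component_comul ⟨t⁻¹ * x, h⟩ y F
    have h3 : (⟨t⁻¹ * (x * y), h'⟩ : H) = ⟨t⁻¹ * x, h⟩ * y := Subtype.ext (mul_assoc _ _ _).symm
    rw [h3]
    refine (congrArg _ h2.symm).trans ?_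
    generalize Coalgebra.comul (R := k) F = z
    induction z with
    | zero => simp
    | add a b ha hb => simp only [map_add, ha, hb]
    | tmul a b => simp
  · have h' : t⁻¹ * (x * y) ∉ H := by
      rwa [← mul_assoc, H.mul_mem_cancel_right y.2]
    rw [component_cosetExtend_of_notMem _ _ h, component_cosetExtend_apply_of_notMem _ _ h']
    simp

/-- Restriction to `G₀ ⋊ H` of a left translate. -/
lemma component_lid_map_evalPoint (t : π) (s : H) (F : α.SemidirectCoord) :
    (α.restrict H).component s (TensorProduct.lid k _ (TensorProduct.map (α.evalPoint t)
      (α.restrictCoord H : α.SemidirectCoord →ₐ[k] _).toLinearMap (Coalgebra.comul (R := k) F))) =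
    α.comorphism t (α.component (t * s) F) := by
  rw [← rTensor_counit_twistedComul, ← map_component_comul]
  generalize Coalgebra.comul (R := k) F = z
  induction z with
  | zero => simp
  | add a b ha hb => simp only [map_add, ha, hb]
  | tmul a b => simp [evalPoint, component_restrictCoord]

/-- Evaluation of a right translate. -/
lemma component_rid_lTensor_evalPoint (x y : π) (F : α.SemidirectCoord) :
    α.component x (TensorProduct.rid k _ ((α.evalPoint y).lTensor _
      (Coalgebra.comul (R := k) F))) =
    TensorProduct.rid k A₀ ((Coalgebra.counit (R := k)).lTensor A₀
      (α.twistedComul x (α.component (x * y) F))) := by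
  rw [← map_component_comul]
  generalize Coalgebra.comul (R := k) F = z
  induction z with
  | zero => simp
  | add a b ha hb => simp only [map_add, ha, hb]
  | tmul a b => simp [evalPoint]

/-- Representatives of the left cosets of `H` in `π` form a transversal of `G₀ ⋊ H`
in `G₀ ⋊ π`. -/
theorem isTransversal_cosets [Fintype (π ⧸ H)] :
    RationalModule.IsTransversal (α.restrictCoord H) (fun t : π ⧸ H => α.evalPoint t.out)
      (fun t : π ⧸ H => α.cosetExtend H t.out) where
  colinear t F := α.cosetExtend_colinear H t.out F
  sum_eq F := by
    refine α.coord_ext fun x => ?_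
    rw [map_sum, Finset.sum_eq_single (x : π ⧸ H)]
    -- Only the coset of `x` contributes to the component at `x`; there, translation by `t` and then
    -- by `t⁻¹` cancels.
    · have h := (out_inv_mul_mem_iff H (x : π ⧸ H) x).2 rfl
      rw [component_cosetExtend_apply_of_mem _ _ h, component_lid_map_evalPoint,
        ← comorphism_mul_apply, mul_inv_cancel, comorphism_one_apply]
      simp
    · intro t _ ht
      exact α.component_cosetExtend_apply_of_notMem H (mt (out_inv_mul_mem_iff H t x).1 ht) _
    · simp
  sum_translate t := by
    refine α.coord_ext fun x => ?_
    -- The condition `x s ∈ t H` singles out one coset, that of `x⁻¹ t`, so exactly one term of the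
    -- sum survives at `x`.
    have hiff : ∀ s : π ⧸ H, t.out⁻¹ * (x * s.out) ∈ H ↔ s = ((x⁻¹ * t.out : π) : π ⧸ H) := by
      intro s
      rw [← out_inv_mul_mem_iff, ← H.inv_mem_iff]
      simp [mul_assoc]
    rw [map_sum, Finset.sum_eq_single ((x⁻¹ * t.out : π) : π ⧸ H)]
    · rw [component_rid_lTensor_evalPoint,
        component_cosetExtend_apply_of_mem _ _ ((hiff _).2 rfl)]
      simp [Algebra.TensorProduct.one_def]
    · intro s _ hs
      rw [component_rid_lTensor_evalPoint,
        component_cosetExtend_apply_of_notMem _ _ (mt (hiff s).1 hs)]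
      simp
    · simp
  apply_one t := by simp [evalPoint]

end Transversal

end GroupSchemeAction

/-! ### Transport to `G` and the Sylow subgroup -/

/-- Transversals can be transported along isomorphisms of the ambient group scheme. -/
lemma RationalModule.IsTransversal.comp_equiv {k A A' B : Type*} [Field k] [CommRing A]
    [Bialgebra k A] [CommRing A'] [Bialgebra k A'] [CommRing B] [Bialgebra k B] {φ : A →ₐc[k] B}
    {T : Type*} [Fintype T] {ε : T → A →ₗ[k] k} {ι : T → B →ₗ[k] A}
    (h : RationalModule.IsTransversal φ ε ι) (e : A' ≃ₐc[k] A) :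
    RationalModule.IsTransversal (φ.comp (e : A' →ₐc[k] A)) (fun t => ε t ∘ₗ (e : A' →ₗ[k] A))
      (fun t => (e.symm : A →ₗ[k] A') ∘ₗ ι t) := by
  have he : ∀ a, Coalgebra.comul (R := k) (e.symm a) =
      TensorProduct.map (e.symm : A →ₗ[k] A') (e.symm : A →ₗ[k] A') (Coalgebra.comul (R := k) a) :=
    fun a => (CoalgHomClass.map_comp_comul_apply e.symm a).symm
  have hcomul : ∀ a, Coalgebra.comul (R := k) (e a) =
      TensorProduct.map (e : A' →ₗ[k] A) (e : A' →ₗ[k] A) (Coalgebra.comul (R := k) a) :=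
    fun a => (CoalgHomClass.map_comp_comul_apply e a).symm
  refine ⟨fun t b => ?_, fun a => ?_, fun t => ?_, fun t => ?_⟩
  · have h1 := h.colinear t b
    change LinearMap.lTensor _ _ (Coalgebra.comul (R := k) (e.symm (ι t b))) = _
    rw [he, LinearMap.rTensor_comp_apply, ← h1]
    generalize Coalgebra.comul (R := k) (ι t b) = z
    induction z with
    | zero => simp
    | add a b ha hb => simp only [map_add, ha, hb]
    | tmul a b => simp
  -- Applying `e` to both sides reduces the decomposition of `a` to that of `e a`.
  · refine e.toAlgEquiv.injective ((map_sum e.toAlgEquiv _ _).trans (Eq.trans ?_ (h.sum_eq (e a))))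
    rw [hcomul]
    refine Finset.sum_congr rfl fun t _ => ?_
    refine (e.apply_symm_apply _).trans (congrArg (ι t) (congrArg _ ?_))
    generalize Coalgebra.comul (R := k) a = z
    induction z with
    | zero => simp
    | add a b ha hb => simp only [map_add, ha, hb]
    | tmul a b => simp
  · refine Eq.trans ?_ ((congrArg e.symm (h.sum_translate t)).trans (map_one _))
    rw [map_sum]
    refine Finset.sum_congr rfl fun s _ => ?_
    change TensorProduct.rid k A' (LinearMap.lTensor _ _
      (Coalgebra.comul (R := k) (e.symm (ι t 1)))) = _
    rw [he]
    generalize Coalgebra.comul (R := k) (ι t 1) = z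
    induction z with
    | zero => simp
    | add a b ha hb => simp only [map_add, ha, hb]
    | tmul a b => simp
  · exact (congrArg (ε t) (map_one e)).trans (h.apply_one t)

theorem lemma5p4 {k : Type u} [Field k] (p : ℕ) [Fact p.Prime] [CharP k p]
    {A₀ : Type v} [CommRing A₀] [HopfAlgebra k A₀] [Module.Finite k A₀] [IsLocalRing A₀]
    {π : Type w} [Group π] [Finite π] (α : GroupSchemeAction k π A₀)
    {A : Type v'} [CommRing A] [HopfAlgebra k A] (e : A ≃ₐc[k] α.SemidirectCoord)
    (πS : Sylow p π) (M : RationalModule.{u} k A) (n : ℕ) :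
    Function.Injective (RationalModule.cohomologyRes
      ((α.restrictCoord (πS : Subgroup π)).comp (e : A →ₐc[k] α.SemidirectCoord)) M n) := by
  have := Fintype.ofFinite (π ⧸ (πS : Subgroup π))
  have : Module.Finite k α.SemidirectCoord := inferInstanceAs (Module.Finite k (π → A₀))
  have : Module.Finite k A := Module.Finite.equiv (e.symm : α.SemidirectCoord ≃ₗ[k] A)
  refine ((α.isTransversal_cosets (πS : Subgroup π)).comp_equiv e).cohomologyRes_injective ?_ M n
  -- The transversal has as many points as there are cosets, so its cardinality vanishes in `k`
  -- exactly when `p` divides the index of `πS`.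
  rw [Ne, CharP.cast_eq_zero_iff k p, ← Nat.card_eq_fintype_card]
  exact πS.not_dvd_index
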